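/- Let $d\ge 1$, $R>0$, and identify functions on $[-\pi,\pi]^d$ with their $2\pi$-periodic extensions. Let the collision kernel $B(|q|,\cos\theta)\ge 0$ be measurable and such that $\int_{\mathbb S^{d-1}}B(s,e\cdot\sigma)\,d\sigma$ is bounded uniformly for $0<s\le 2R$ and $e\in\mathbb S^{d-1}$ (for example, $B$ bounded). The truncated, periodized collision operator is $$Q^R(f,f)(v)=\int_{\mathcal B_0(2R)\times\mathbb S^{d-1}}B(|q|,\cos\theta)\,\bigl(f(v'_*)f(v')-f(v_*)f(v)\bigr)\,dq\,d\sigma,$$ where $v_*=v-q$, $\cos\theta=\frac{q}{|q|}\cdot\sigma$, $v'=v-\tfrac12(q-|q|\sigma)$, $v'_*=v-\tfrac12(q+|q|\sigma)$. Let $\Phi(v)=(1,v_1,\dots,v_d,|v|^2)$ on $[-\pi,\pi]^d$, $\langle f,\Phi\rangle=\int_{[-\pi,\pi]^d}f\,\Phi\,dv$, and let $\|\cdot\|_2$ be the Euclidean norm. For an integer $N\ge 1$ let $\mathbb P^N=\mathrm{span}\{e^{ik\cdot v}: |k_j|\le N,\ j=1,\dots,d\}$, let $$f_N^c=\mathrm{argmin}\{\|g-f\|_{L^2}: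 g\in\mathbb P^N,\ \langle g,\Phi\rangle=\langle f,\Phi\rangle\},$$ $$Q_N^{R,c}(h,h)=\mathrm{argmin}\{\|g-Q^R(h,h)\|_{L^2}: g\in\mathbb P^N,\ \langle g,\Phi\rangle=0\},$$ and let $\|h\|_{H^r_p}^2=(2\pi)^d\sum_{k\in\mathbb Z^d}(1+|k|^2)^r|\hat h_k|^2$ be the periodic Sobolev norm, where $\hat h_k=(2\pi)^{-d}\int_{[-\pi,\pi]^d}h(v)e^{-ik\cdot v}\,dv$. Then for all $\tilde C>0$, $K\ge 0$ and real $r\ge 1$ there is a constant $C$, depending only on $d,B,R,\tilde C,K,r$, such that the following holds. If $f\in L^2([-\pi,\pi]^d;\mathbb C)$ satisfies $\|f\|_{L^2}\le K$ and, for some $\delta>0$, $$\|\langle Q^R(f,f),\Phi\rangle\|_2\le\tilde C\,\delta,$$ then for every integer $N\ge 1$ $$\|Q^R(f,f)-Q_N^{R,c}(f_N^c,f_N^c)\|_{L^2}\le C\left(\|f-f_N^c\|_{L^2}+\frac{\|Q^R(f_N^c,f_N^c)\|_{H^r_p}}{N^r}+\delta\right).$$ -/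

import Mathlib

open MeasureTheory
open scoped Real ENNReal NNReal

namespace BoltzmannSpectral

instance fact_two_pi_pos : Fact (0 < 2 * π) := ⟨Real.two_pi_pos⟩

/-- The velocity space `ℝ^d` with its Euclidean norm. -/
abbrev Velocity (d : ℕ) : Type := EuclideanSpace ℝ (Fin d)

/-- The periodic box `[-π, π]^d`, that is `(ℝ / 2πℤ)^d`; its `volume` has total mass `(2π)^d`. -/
abbrev Torus (d : ℕ) : Type := Fin d → AddCircle (2 * π)

/-- The class in the periodic box of a velocity of `ℝ^d`. -/
noncomputable def toTorus {d : ℕ} (z : Velocity d) : Torus d :=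
  fun i => ((z i : ℝ) : AddCircle (2 * π))

/-- The representative in `(-π, π]` of a point of `ℝ / 2πℤ`. -/
noncomputable def boxCoord (x : AddCircle (2 * π)) : ℝ :=
  (AddCircle.equivIoc (2 * π) (-π) x : ℝ)

/-- The index set of the `d + 2` moments: mass, the `d` components of momentum, energy. -/
abbrev MomentIndex (d : ℕ) : Type := Unit ⊕ Fin d ⊕ Unit

/-- The collision invariants `Φ(v) = (1, v_1, …, v_d, |v|²)` for `v` in the box. -/
noncomputable def collisionInvariant {d : ℕ} : MomentIndex d → Torus d → ℝ
  | Sum.inl _, _ => 1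
  | Sum.inr (Sum.inl j), v => boxCoord (v j)
  | Sum.inr (Sum.inr _), v => ∑ j, boxCoord (v j) ^ 2

/-- The moment vector `⟨f, Φ⟩`, with its Euclidean norm. -/
noncomputable def moments {d : ℕ} (f : Torus d → ℂ) : EuclideanSpace ℂ (MomentIndex d) :=
  WithLp.toLp 2 fun i => ∫ v, f v * (collisionInvariant i v : ℂ)

/-- The trigonometric monomial `v ↦ exp (i k · v)`. -/
noncomputable def expMonomial {d : ℕ} (k : Fin d → ℤ) : C(Torus d, ℂ) where
  toFun v := ∏ i, fourier (k i) (v i)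
  continuous_toFun := by fun_prop

/-- The space `ℙ^N` of trigonometric polynomials of degree at most `N` in each variable. -/
noncomputable def trigPoly (d N : ℕ) : Submodule ℂ C(Torus d, ℂ) :=
  Submodule.span ℂ (expMonomial '' {k : Fin d → ℤ | ∀ i, |k i| ≤ (N : ℤ)})

/-- The Fourier coefficient `ĥ_k = (2π)^{-d} ∫ h(v) exp (-i k · v) dv`. -/
noncomputable def fourierCoefficient {d : ℕ} (h : Torus d → ℂ) (k : Fin d → ℤ) : ℂ :=
  ((2 * π) ^ d : ℝ)⁻¹ * ∫ v, h v * expMonomial (-k) v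

/-- The periodic Sobolev norm, `‖h‖² = (2π)^d ∑_k (1 + |k|²)^r |ĥ_k|²`
(with value `∞` if the series diverges). -/
noncomputable def sobolevNorm {d : ℕ} (r : ℝ) (h : Torus d → ℂ) : ℝ≥0∞ :=
  (∑' k : Fin d → ℤ, ENNReal.ofReal ((2 * π) ^ d *
    ((1 + ∑ i, (k i : ℝ) ^ 2) ^ r * ‖fourierCoefficient h k‖ ^ 2))) ^ (1 / 2 : ℝ)

/-- `g` is a minimizer of `‖g - h‖_{L²}` among the trigonometric polynomials in `ℙ^N`
whose moment vector is `U`. -/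
def IsConstrainedBest {d : ℕ} (N : ℕ) (h : Torus d → ℂ) (U : EuclideanSpace ℂ (MomentIndex d))
    (g : C(Torus d, ℂ)) : Prop :=
  (g ∈ trigPoly d N ∧ moments g = U) ∧
    ∀ g' : C(Torus d, ℂ), g' ∈ trigPoly d N → moments g' = U →
      eLpNorm (fun v => g v - h v) 2 volume ≤ eLpNorm (fun v => g' v - h v) 2 volume

/-- The minimizer (argmin) of the constrained least squares problem; it exists and is unique for
`d, N ≥ 1` and `h ∈ L²`, see `existsUnique_isConstrainedBest`. -/
noncomputable def constrainedBest {d : ℕ} (N : ℕ) (h : Torus d → ℂ)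
    (U : EuclideanSpace ℂ (MomentIndex d)) : C(Torus d, ℂ) :=
  Classical.epsilon (IsConstrainedBest N h U)

/-- The conservative projection `f_N^c` of `f`: best approximation with the moments of `f`. -/
noncomputable def conservativeProjection {d : ℕ} (N : ℕ) (f : Torus d → ℂ) : C(Torus d, ℂ) :=
  constrainedBest N f (moments f)

/-- The truncated, periodized collision operator
`Q^R(f,g)(v) = ∫_{B_0(2R) × S^{d-1}} B(|q|, cos θ) (f(v'_*) g(v') - f(v_*) g(v)) dq dσ`, where
`q = v - v_*` is the relative velocity, `cos θ = (q / |q|) · σ`,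
`v' = (v + v_*)/2 + |q| σ / 2 = v - (q - |q| σ)/2`,
`v'_* = (v + v_*)/2 - |q| σ / 2 = v - (q + |q| σ)/2`. -/
noncomputable def collision {d : ℕ} (B : ℝ → ℝ → ℝ) (R : ℝ) (f g : Torus d → ℂ)
    (v : Torus d) : ℂ :=
  ∫ p : Velocity d × Metric.sphere (0 : Velocity d) 1,
    (B ‖p.1‖ (inner ℝ (‖p.1‖⁻¹ • p.1) (p.2 : Velocity d)) : ℂ) *
      (f (v - toTorus ((1 / 2 : ℝ) • (p.1 + ‖p.1‖ • (p.2 : Velocity d)))) *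
          g (v - toTorus ((1 / 2 : ℝ) • (p.1 - ‖p.1‖ • (p.2 : Velocity d)))) -
        f (v - toTorus p.1) * g v)
    ∂((volume.restrict (Metric.ball (0 : Velocity d) (2 * R))).prod
      (volume : Measure (Velocity d)).toSphere)

/-- The moment constrained operator `Q_N^{R,c}(f,f)`: the best approximation of `Q^R(f,f)` in
`ℙ^N` among polynomials with vanishing moments. -/
noncomputable def constrainedCollision {d : ℕ} (B : ℝ → ℝ → ℝ) (R : ℝ) (N : ℕ)
    (f : Torus d → ℂ) : C(Torus d, ℂ) :=
  constrainedBest N (collision B R f f) 0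

/-- Admissible collision kernels `B(|v - v_*|, cos θ)` on the truncated domain: measurable,
non-negative, with total cross section bounded for relative speeds at most `2R`.
In particular every bounded measurable non-negative kernel is admissible. -/
structure IsAdmissibleKernel (d : ℕ) (R : ℝ) (B : ℝ → ℝ → ℝ) : Prop where
  measurable : Measurable (Function.uncurry B)
  nonneg : ∀ s c, 0 ≤ B s c
  bounded : ∃ M : ℝ≥0, ∀ s : ℝ, 0 < s → s ≤ 2 * R → ∀ e : Metric.sphere (0 : Velocity d) 1,
    ∫⁻ σ : Metric.sphere (0 : Velocity d) 1,
      ENNReal.ofReal (B s (inner ℝ (e : Velocity d) (σ : Velocity d)))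
        ∂(volume : Measure (Velocity d)).toSphere ≤ M

/-! ### The constrained least squares problem is well posed -/

lemma measurable_boxCoord : Measurable boxCoord :=
  measurable_subtype_coe.comp (AddCircle.measurableEquivIoc (2 * π) (-π)).measurable

lemma abs_boxCoord_le (x : AddCircle (2 * π)) : |boxCoord x| ≤ π := by
  have h := (AddCircle.equivIoc (2 * π) (-π) x).2
  rw [abs_le]
  exact ⟨h.1.le, by have := h.2; unfold boxCoord; linarith⟩

lemma measurable_collisionInvariant {d : ℕ} (i : MomentIndex d) :
    Measurable (collisionInvariant i) := by
  rcases i with _ | j | _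
  · exact measurable_const
  · exact measurable_boxCoord.comp (measurable_pi_apply j)
  · exact Finset.measurable_sum _ fun j _ =>
      (measurable_boxCoord.comp (measurable_pi_apply j)).pow_const 2

lemma exists_bound_collisionInvariant {d : ℕ} (i : MomentIndex d) :
    ∃ K : ℝ, ∀ v, |collisionInvariant i v| ≤ K := by
  rcases i with _ | j | _
  · exact ⟨1, fun v => by simp [collisionInvariant]⟩
  · exact ⟨π, fun v => abs_boxCoord_le _⟩
  · refine ⟨∑ _j : Fin d, π ^ 2, fun v => ?_⟩
    refine (Finset.abs_sum_le_sum_abs _ _).trans (Finset.sum_le_sum fun j _ => ?_)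
    rw [abs_pow]
    exact pow_le_pow_left₀ (abs_nonneg _) (abs_boxCoord_le _) 2

lemma integrable_moment {d : ℕ} {f : Torus d → ℂ} (hf : Integrable f) (i : MomentIndex d) :
    Integrable fun v => f v * (collisionInvariant i v : ℂ) := by
  obtain ⟨K, hK⟩ := exists_bound_collisionInvariant i
  refine hf.mul_bdd (c := K)
    (Complex.measurable_ofReal.comp (measurable_collisionInvariant i)).aestronglyMeasurable ?_
  exact Filter.Eventually.of_forall fun v => by simpa using hK v

lemma integrable_continuous {d : ℕ} (g : C(Torus d, ℂ)) : Integrable g :=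
  g.continuous.integrable_of_hasCompactSupport (HasCompactSupport.of_compactSpace _)

/-- The moment vector as a linear map on continuous functions. -/
noncomputable def momentsLinear (d : ℕ) :
    C(Torus d, ℂ) →ₗ[ℂ] EuclideanSpace ℂ (MomentIndex d) where
  toFun g := moments g
  map_add' f g := by
    ext i
    simp only [moments, ContinuousMap.coe_add, Pi.add_apply, add_mul, PiLp.add_apply]
    exact integral_add (integrable_moment (integrable_continuous f) i)
      (integrable_moment (integrable_continuous g) i)
  map_smul' c g := by
    ext i
    simp only [moments, ContinuousMap.coe_smul, Pi.smul_apply, smul_eq_mul, mul_assoc,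
      PiLp.smul_apply, RingHom.id_apply]
    exact integral_const_mul _ _

lemma integral_circle (F : AddCircle (2 * π) → ℂ) :
    ∫ x, F x = ∫ t in (-π)..π, F (t : AddCircle (2 * π)) := by
  rw [← AddCircle.intervalIntegral_preimage (2 * π) (-π) F]
  congr 1
  ring

lemma boxCoord_coe {t : ℝ} (ht : t ∈ Set.Ioc (-π) π) : boxCoord (t : AddCircle (2 * π)) = t :=
  AddCircle.equivIoc_coe_of_mem (p := 2 * π) (a := -π) ⟨ht.1, by linarith [ht.2]⟩

lemma fourier_coe (s : ℤ) (t : ℝ) :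
    fourier s (t : AddCircle (2 * π)) = Complex.exp (Complex.I * s * t) := by
  rw [fourier_coe_apply]
  congr 1
  have : (π : ℂ) ≠ 0 := by exact_mod_cast Real.pi_ne_zero
  push_cast
  field_simp

lemma integral_fourier_boxCoord (s : ℤ) (n : ℕ) :
    ∫ x : AddCircle (2 * π), fourier s x * ((boxCoord x : ℝ) : ℂ) ^ n =
      ∫ t in (-π)..π, Complex.exp (Complex.I * s * t) * (t : ℂ) ^ n := by
  rw [integral_circle]
  refine intervalIntegral.integral_congr_ae (Filter.Eventually.of_forall fun t ht => ?_)
  rw [Set.uIoc_of_le (by linarith [Real.pi_pos])] at ht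
  rw [boxCoord_coe ht, fourier_coe]

lemma exp_mul_pi {s : ℤ} (hs : s = 1 ∨ s = -1) :
    Complex.exp (Complex.I * s * π) = -1 ∧ Complex.exp (Complex.I * s * (-π : ℝ)) = -1 := by
  have h1 : Complex.exp (Complex.I * π) = -1 := by rw [mul_comm, Complex.exp_pi_mul_I]
  have h2 : Complex.exp (-(Complex.I * π)) = -1 := by rw [Complex.exp_neg, h1]; norm_num
  rcases hs with rfl | rfl <;> simp [h1, h2]

lemma integral_exp_of_antideriv {s : ℤ} {n : ℕ} {P P' : ℂ → ℂ}
    (hP : ∀ z, HasDerivAt P (P' z) z)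
    (hz : ∀ z, P' z + P z * (Complex.I * s) = z ^ n) :
    ∫ t in (-π)..π, Complex.exp (Complex.I * s * t) * (t : ℂ) ^ n =
      P π * Complex.exp (Complex.I * s * π) -
        P (-π : ℝ) * Complex.exp (Complex.I * s * (-π : ℝ)) := by
  refine intervalIntegral.integral_eq_sub_of_hasDerivAt
    (f := fun t : ℝ => P t * Complex.exp (Complex.I * s * t)) (fun t _ => ?_) ?_
  · have he : HasDerivAt (fun z : ℂ => Complex.exp (Complex.I * s * z))
        (Complex.exp (Complex.I * s * t) * (Complex.I * s)) (t : ℂ) := by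
      simpa using ((hasDerivAt_id (t : ℂ)).const_mul (Complex.I * s)).cexp
    have := ((hP t).mul he).comp_ofReal
    have heq : P' t * Complex.exp (Complex.I * s * t) +
        P t * (Complex.exp (Complex.I * s * t) * (Complex.I * s)) =
          Complex.exp (Complex.I * s * t) * (t : ℂ) ^ n := by
      rw [← hz]
      ring
    rw [heq] at this
    exact this
  · exact Continuous.intervalIntegrable (by fun_prop) _ _

lemma sq_eq_one_cast {s : ℤ} (hs : s = 1 ∨ s = -1) : (s : ℂ) ^ 2 = 1 := by
  rcases hs with rfl | rfl <;> simp

lemma integral_fourier_zero {s : ℤ} (hs : s = 1 ∨ s = -1) :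
    ∫ x : AddCircle (2 * π), fourier s x = 0 := by
  have h := integral_fourier_boxCoord s 0
  simp only [pow_zero, mul_one] at h
  have h' := integral_exp_of_antideriv (s := s) (n := 0) (P := fun _ => -Complex.I * s)
    (P' := fun _ => 0) (fun z => hasDerivAt_const _ _) (fun z => by
      linear_combination (-(s : ℂ) ^ 2) * Complex.I_sq + sq_eq_one_cast hs)
  simp only [pow_zero, mul_one] at h'
  rw [h, h', (exp_mul_pi hs).1, (exp_mul_pi hs).2]
  ring

lemma integral_fourier_one {s : ℤ} (hs : s = 1 ∨ s = -1) :
    ∫ x : AddCircle (2 * π), fourier s x * ((boxCoord x : ℝ) : ℂ) = 2 * π * Complex.I * s := by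
  have h := integral_fourier_boxCoord s 1
  simp only [pow_one] at h
  have h' := integral_exp_of_antideriv (s := s) (n := 1)
    (P := fun z => -Complex.I * s * z + 1)
    (P' := fun _ => -Complex.I * s)
    (fun z => by simpa using ((hasDerivAt_id z).const_mul (-Complex.I * s)).add_const 1)
    (fun z => by
      linear_combination (-(s : ℂ) ^ 2 * z) * Complex.I_sq + z * sq_eq_one_cast hs)
  simp only [pow_one] at h'
  rw [h, h', (exp_mul_pi hs).1, (exp_mul_pi hs).2]
  push_cast
  ring

lemma integral_fourier_two {s : ℤ} (hs : s = 1 ∨ s = -1) :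
    ∫ x : AddCircle (2 * π), fourier s x * ((boxCoord x : ℝ) : ℂ) ^ 2 = -4 * π := by
  rw [integral_fourier_boxCoord s 2, integral_exp_of_antideriv (s := s) (n := 2)
    (P := fun z => -Complex.I * s * z ^ 2 + 2 * z + 2 * Complex.I * s)
    (P' := fun z => -Complex.I * s * (2 * z) + 2)
    (fun z => by
      have h1 : HasDerivAt (fun z : ℂ => -Complex.I * s * z ^ 2)
          (-Complex.I * s * (2 * z)) z := by
        simpa using ((hasDerivAt_id z).pow 2).const_mul (-Complex.I * s)
      have h2 : HasDerivAt (fun z : ℂ => 2 * z) 2 z := by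
        simpa using (hasDerivAt_id z).const_mul (2 : ℂ)
      exact (h1.add h2).add_const _)
    (fun z => by
      linear_combination ((s : ℂ) ^ 2 * (2 - z ^ 2)) * Complex.I_sq +
        (z ^ 2 - 2) * sq_eq_one_cast hs),
    (exp_mul_pi hs).1, (exp_mul_pi hs).2]
  push_cast
  ring

lemma integral_monomial_mul {d : ℕ} (k : Fin d → ℤ) (j : Fin d) (w : AddCircle (2 * π) → ℂ) :
    ∫ v : Torus d, expMonomial k v * w (v j) =
      ∏ i, ∫ x : AddCircle (2 * π), fourier (k i) x * (if i = j then w x else 1) := by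
  rw [← integral_fintype_prod_volume_eq_prod
    (fun i (x : AddCircle (2 * π)) => fourier (k i) x * (if i = j then w x else 1))]
  refine integral_congr_ae (Filter.Eventually.of_forall fun v => ?_)
  beta_reduce
  rw [Finset.prod_mul_distrib, Finset.prod_ite_eq' Finset.univ j (fun i => w (v i)),
    if_pos (Finset.mem_univ j)]
  rfl

lemma integral_single_mul_of_ne {d : ℕ} {s : ℤ} (hs : s = 1 ∨ s = -1) {l j : Fin d}
    (hlj : l ≠ j) (w : AddCircle (2 * π) → ℂ) :
    ∫ v : Torus d, expMonomial (Pi.single l s) v * w (v j) = 0 := by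
  rw [integral_monomial_mul]
  refine Finset.prod_eq_zero (Finset.mem_univ l) ?_
  simpa [hlj] using integral_fourier_zero hs

lemma integral_single_mul_self {d : ℕ} (s : ℤ) (j : Fin d) (w : AddCircle (2 * π) → ℂ) :
    ∫ v : Torus d, expMonomial (Pi.single j s) v * w (v j) =
      (∫ x : AddCircle (2 * π), fourier s x * w x) * (2 * π) ^ (d - 1) := by
  rw [integral_monomial_mul, ← Finset.mul_prod_erase _ _ (Finset.mem_univ j)]
  congr 1
  · simp
  · rw [Finset.prod_congr rfl (g := fun _ => (2 * π : ℂ))]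
    · simp
    · intro i hi
      have hij := Finset.ne_of_mem_erase hi
      have hv : volume.real (Set.univ : Set (AddCircle (2 * π))) = 2 * π := by
        rw [Measure.real, AddCircle.measure_univ, ENNReal.toReal_ofReal Real.two_pi_pos.le]
      simp [hij, hv]

lemma momentsLinear_single {d : ℕ} {s : ℤ} (hs : s = 1 ∨ s = -1) (l : Fin d) :
    (momentsLinear d (expMonomial (Pi.single l s)) (Sum.inl ()) = 0) ∧
    (∀ j, momentsLinear d (expMonomial (Pi.single l s)) (Sum.inr (Sum.inl j)) =
      if l = j then 2 * π * Complex.I * s * (2 * π) ^ (d - 1) else 0) ∧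
    (momentsLinear d (expMonomial (Pi.single l s)) (Sum.inr (Sum.inr ())) =
      -4 * π * (2 * π) ^ (d - 1)) := by
  refine ⟨?_, fun j => ?_, ?_⟩
  · have := integral_single_mul_self s l (fun _ => 1)
    simp only [mul_one, integral_fourier_zero hs, zero_mul] at this
    simpa [momentsLinear, moments, collisionInvariant] using this
  · change ∫ v : Torus d, expMonomial (Pi.single l s) v * ((boxCoord (v j) : ℝ) : ℂ) = _
    split_ifs with h
    · subst h
      rw [integral_single_mul_self s l (fun x => ((boxCoord x : ℝ) : ℂ)), integral_fourier_one hs]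
    · exact integral_single_mul_of_ne hs h (fun x => ((boxCoord x : ℝ) : ℂ))
  · change ∫ v : Torus d, expMonomial (Pi.single l s) v *
      ((∑ j, boxCoord (v j) ^ 2 : ℝ) : ℂ) = _
    have hint : ∀ j ∈ (Finset.univ : Finset (Fin d)), Integrable fun v : Torus d =>
        expMonomial (Pi.single l s) v * ((boxCoord (v j) : ℝ) : ℂ) ^ 2 := by
      intro j _
      refine (integrable_continuous (expMonomial (Pi.single l s))).mul_bdd (c := π ^ 2)
        ((Complex.measurable_ofReal.comp
          (measurable_boxCoord.comp (measurable_pi_apply j))).pow_const 2).aestronglyMeasurable ?_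
      refine Filter.Eventually.of_forall fun v => ?_
      rw [norm_pow]
      exact pow_le_pow_left₀ (norm_nonneg _) (by simpa using abs_boxCoord_le (v j)) 2
    push_cast
    simp_rw [Finset.mul_sum]
    rw [integral_finsetSum _ hint, Finset.sum_eq_single l]
    · rw [integral_single_mul_self s l (fun x => ((boxCoord x : ℝ) : ℂ) ^ 2),
        integral_fourier_two hs]
    · intro j _ hj
      exact integral_single_mul_of_ne hs hj.symm (fun x => ((boxCoord x : ℝ) : ℂ) ^ 2)
    · simp

lemma momentsLinear_one (d : ℕ) :
    momentsLinear d (expMonomial 0) (Sum.inl ()) = (2 * π) ^ d := by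
  have hv : volume.real (Set.univ : Set (Torus d)) = (2 * π) ^ d := by
    rw [Measure.real, volume_pi, Measure.pi_univ]
    simp [Real.pi_pos.le]
  have : ∀ v : Torus d, expMonomial (0 : Fin d → ℤ) v = 1 := fun v => by simp [expMonomial]
  simp [momentsLinear, moments, collisionInvariant, this, hv]

lemma expMonomial_mem {d N : ℕ} {k : Fin d → ℤ} (hk : ∀ i, |k i| ≤ (N : ℤ)) :
    expMonomial k ∈ trigPoly d N :=
  Submodule.subset_span ⟨k, hk, rfl⟩

/-- Every moment vector is attained on `ℙ^N`, for `d, N ≥ 1`. -/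
lemma exists_moments_eq {d N : ℕ} (hd : 1 ≤ d) (hN : 1 ≤ N)
    (U : EuclideanSpace ℂ (MomentIndex d)) :
    ∃ g ∈ trigPoly d N, momentsLinear d g = U := by
  have hmem : ∀ (l : Fin d) (s : ℤ), s = 1 ∨ s = -1 →
      expMonomial (Pi.single l s) ∈ trigPoly d N := by
    intro l s hs
    refine expMonomial_mem fun i => ?_
    have hN' : (1 : ℤ) ≤ N := by exact_mod_cast hN
    rcases eq_or_ne i l with rfl | h
    · rcases hs with rfl | rfl <;> simpa using hN'
    · simp [h]
  have h1 : (1 : ℤ) = 1 ∨ (1 : ℤ) = -1 := Or.inl rfl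
  have h2 : (-1 : ℤ) = 1 ∨ (-1 : ℤ) = -1 := Or.inr rfl
  have hpi : (π : ℂ) ≠ 0 := by exact_mod_cast Real.pi_ne_zero
  have hI : Complex.I ≠ 0 := Complex.I_ne_zero
  set c : ℂ := (2 * π) ^ (d - 1) with hc
  have hc0 : c ≠ 0 := by rw [hc]; exact pow_ne_zero _ (mul_ne_zero two_ne_zero hpi)
  let l0 : Fin d := ⟨0, hd⟩
  set o := momentsLinear d (expMonomial 0) with ho
  let a : ℂ := U (Sum.inl ()) / (2 * π) ^ d
  let b : Fin d → ℂ := fun j =>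
    (U (Sum.inr (Sum.inl j)) - a * o (Sum.inr (Sum.inl j))) / (4 * π * Complex.I * c)
  let e : ℂ := (U (Sum.inr (Sum.inr ())) - a * o (Sum.inr (Sum.inr ()))) / (-8 * π * c)
  let S : Fin d → C(Torus d, ℂ) := fun j =>
    expMonomial (Pi.single j 1) - expMonomial (Pi.single j (-1))
  let T : C(Torus d, ℂ) := expMonomial (Pi.single l0 1) + expMonomial (Pi.single l0 (-1))
  refine ⟨a • expMonomial 0 + ∑ j, b j • S j + e • T, ?_, ?_⟩
  · refine add_mem (add_mem (Submodule.smul_mem _ _ (expMonomial_mem fun i => by simp))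
      (Submodule.sum_mem _ fun j _ => Submodule.smul_mem _ _ (sub_mem (hmem j 1 h1)
        (hmem j (-1) h2)))) (Submodule.smul_mem _ _ (add_mem (hmem _ 1 h1) (hmem _ (-1) h2)))
  · have hpow : ((2 * π : ℂ)) ^ d ≠ 0 := pow_ne_zero _ (mul_ne_zero two_ne_zero hpi)
    ext i
    simp only [S, T, map_add, map_sub, map_sum, map_smul, PiLp.add_apply, PiLp.smul_apply,
      smul_eq_mul, WithLp.ofLp_sum, Finset.sum_apply, WithLp.ofLp_sub, WithLp.ofLp_smul,
      Pi.smul_apply, Pi.sub_apply, ← ho]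
    rcases i with _ | j | _
    · rw [(momentsLinear_single h1 l0).1, (momentsLinear_single h2 l0).1, ho,
        momentsLinear_one]
      simp only [(momentsLinear_single h1 _).1, (momentsLinear_single h2 _).1]
      simp only [a]
      field_simp
      simp
    · rw [(momentsLinear_single h1 l0).2.1, (momentsLinear_single h2 l0).2.1]
      simp only [(momentsLinear_single h1 _).2.1, (momentsLinear_single h2 _).2.1]
      rw [Finset.sum_eq_single j]
      · simp only [if_true, b, ← hc]
        split_ifs <;> · push_cast; field_simp; ring
      · intro i _ hij
        simp [hij]
      · simp
    · rw [(momentsLinear_single h1 l0).2.2, (momentsLinear_single h2 l0).2.2]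
      simp only [(momentsLinear_single h1 _).2.2, (momentsLinear_single h2 _).2.2, sub_self,
        mul_zero, Finset.sum_const_zero, e, ← hc]
      field_simp
      ring

instance finiteDimensional_trigPoly (d N : ℕ) : FiniteDimensional ℂ (trigPoly d N) := by
  refine FiniteDimensional.span_of_finite ℂ (Set.Finite.image _ ?_)
  refine (Set.Finite.pi' (fun _ : Fin d => Set.finite_Icc (-(N : ℤ)) N)).subset fun k hk i => ?_
  exact abs_le.1 (hk i)

/-- For `d, N ≥ 1` and `h ∈ L²` the constrained least squares problem has exactly one solution. -/
theorem existsUnique_isConstrainedBest {d N : ℕ} (hd : 1 ≤ d) (hN : 1 ≤ N) {h : Torus d → ℂ}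
    (hh : MemLp h 2 volume) (U : EuclideanSpace ℂ (MomentIndex d)) :
    ∃! g, IsConstrainedBest N h U g := by
  obtain ⟨g0, hg0, hU⟩ := exists_moments_eq hd hN U
  let J := ContinuousMap.toLp (E := ℂ) 2 (volume : Measure (Torus d)) ℂ
  have hJ : Function.Injective J := ContinuousMap.toLp_injective volume
  have hnorm : ∀ g : C(Torus d, ℂ),
      eLpNorm (fun v => g v - h v) 2 volume = ENNReal.ofReal ‖J g - hh.toLp h‖ := by
    intro g
    rw [ofReal_norm, Lp.enorm_def]
    refine eLpNorm_congr_ae ?_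
    filter_upwards [Lp.coeFn_sub (J g) (hh.toLp h), hh.coeFn_toLp,
      ContinuousMap.coeFn_toLp (p := 2) (𝕜 := ℂ) volume g] with v h1 h2 h3
    rw [h1, Pi.sub_apply, h2, h3]
  let W0 : Submodule ℂ C(Torus d, ℂ) := trigPoly d N ⊓ LinearMap.ker (momentsLinear d)
  have : FiniteDimensional ℂ W0 :=
    Submodule.finiteDimensional_of_le (inf_le_left : W0 ≤ trigPoly d N)
  let W : Submodule ℂ (Lp ℂ 2 (volume : Measure (Torus d))) := W0.map J.toLinearMap
  let y := hh.toLp h - J g0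
  obtain ⟨w0, hw0, hw⟩ : W.starProjection y ∈ W := W.starProjection_apply_mem y
  have hw' : J w0 = W.starProjection y := hw
  have hpyth : ∀ u ∈ W0, ‖y - J u‖ * ‖y - J u‖ =
      ‖y - J w0‖ * ‖y - J w0‖ + ‖J w0 - J u‖ * ‖J w0 - J u‖ := by
    intro u hu
    have hsplit : y - J u = (y - J w0) + (J w0 - J u) := by abel
    rw [hsplit]
    refine norm_add_sq_eq_norm_sq_add_norm_sq_of_inner_eq_zero (𝕜 := ℂ) _ _ ?_
    rw [hw']
    refine W.starProjection_inner_eq_zero y _ ?_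
    rw [← hw', ← map_sub]
    exact ⟨w0 - u, W0.sub_mem hw0 hu, rfl⟩
  have hdist : ∀ u, J (g0 + u) - hh.toLp h = -(y - J u) := by
    intro u
    simp only [y, map_add]
    abel
  have hadm : ∀ u ∈ W0, g0 + u ∈ trigPoly d N ∧ moments (g0 + u : C(Torus d, ℂ)) = U := by
    intro u hu
    refine ⟨add_mem hg0 hu.1, ?_⟩
    change momentsLinear d (g0 + u) = U
    rw [map_add, hU, LinearMap.mem_ker.1 hu.2, add_zero]
  have hback : ∀ g : C(Torus d, ℂ), g ∈ trigPoly d N → moments g = U → g - g0 ∈ W0 := by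
    intro g hg hgU
    refine ⟨sub_mem hg hg0, LinearMap.mem_ker.2 ?_⟩
    change momentsLinear d g = U at hgU
    rw [map_sub, hgU, hU, sub_self]
  refine ⟨g0 + w0, ⟨hadm w0 hw0, fun g hg hgU => ?_⟩, fun g hg => ?_⟩
  · have hu := hback g hg hgU
    rw [hnorm, hnorm, show g = g0 + (g - g0) by abel, hdist, hdist, norm_neg, norm_neg]
    refine ENNReal.ofReal_le_ofReal (abs_le_of_sq_le_sq' ?_ (norm_nonneg _)).2
    nlinarith [hpyth _ hu, mul_self_nonneg ‖J w0 - J (g - g0)‖]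
  · have hu := hback g hg.1.1 hg.1.2
    have hle := hg.2 (g0 + w0) (hadm w0 hw0).1 (hadm w0 hw0).2
    have hgg : g = g0 + (g - g0) := by abel
    rw [hnorm, hnorm, ENNReal.ofReal_le_ofReal_iff (norm_nonneg _), hdist w0, hgg, hdist,
      norm_neg, norm_neg] at hle
    have h0 : ‖J w0 - J (g - g0)‖ = 0 := by
      have := hpyth _ hu
      have h3 := mul_self_le_mul_self (norm_nonneg _) hle
      have h4 : ‖J w0 - J (g - g0)‖ * ‖J w0 - J (g - g0)‖ ≤ 0 := by linarith
      exact mul_self_eq_zero.1 (le_antisymm h4 (mul_self_nonneg _))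
    have := hJ (sub_eq_zero.1 (norm_eq_zero.1 h0))
    rw [this]
    abel

theorem constrainedBest_spec {d N : ℕ} (hd : 1 ≤ d) (hN : 1 ≤ N) {h : Torus d → ℂ}
    (hh : MemLp h 2 volume) (U : EuclideanSpace ℂ (MomentIndex d)) :
    IsConstrainedBest N h U (constrainedBest N h U) :=
  Classical.epsilon_spec (existsUnique_isConstrainedBest hd hN hh U).exists

end BoltzmannSpectral

/-! Write `h` for the conservative projection of `f`. The error splits as `Q(f,f) - Q(h,h)` plus the
distance from `Q(h,h)` to its constrained best approximation in `ℙ^N`.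

The first piece is controlled by local Lipschitz continuity of the collision operator on `L²`
(`exists_eLpNorm_collision_sub_le`), which follows from bilinearity, `Q(f,f) - Q(h,h) = Q(f-h,f) +
Q(h,f-h)`, and the bound `‖Q(f,g)‖ ≤ A ‖f‖ ‖g‖`. For that bound, Cauchy-Schwarz with the kernel as
weight reduces matters to integrals of `|f|²|g|²` at two velocities. The loss integral is a
convolution over a ball, and the gain integral equals the loss integral by the change between pre-
and post-collisional velocities (`lintegral_gain_eq_loss`). Moreover `‖h‖` is at most a constant
times `‖f‖`, so the Lipschitz constant is uniform in `N`.

For the second piece, every moment defect can be repaired by a polynomial of degree one of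
proportional norm (`exists_correction`), with a constant free of `N`. Hence the constrained error is
at most the error of the Fourier truncation plus a multiple of its moments. The truncation error is
`O(N^{-r})` by Parseval. The moments of the truncation differ from those of `Q(f,f)` by at most the
truncation error and the Lipschitz error, up to a constant, and those of `Q(f,f)` are `O(δ)` by
assumption. -/

namespace BoltzmannSpectral

/-! ### Polar coordinates and the exchange of the two directions. -/

section Polar

variable {E : Type*} [NormedAddCommGroup E] [NormedSpace ℝ E] [MeasurableSpace E] [BorelSpace E]
  [FiniteDimensional ℝ E] [Nontrivial E]

/-- Integration in polar coordinates. -/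
lemma lintegral_polar (μ : Measure E) [μ.IsAddHaarMeasure] {F : E → ℝ≥0∞} (hF : Measurable F) :
    ∫⁻ q, F q ∂μ = ∫⁻ ω : Metric.sphere (0 : E) 1, ∫⁻ s : Set.Ioi (0 : ℝ),
      F ((s : ℝ) • (ω : E)) ∂Measure.volumeIoiPow (Module.finrank ℝ E - 1) ∂μ.toSphere := by
  have h1 : ∫⁻ q, F q ∂μ = ∫⁻ x : ({(0)}ᶜ : Set E), F x ∂(μ.comap (↑)) := by
    rw [lintegral_subtype_comap (measurableSet_singleton _).compl, restrict_compl_singleton]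
  have h2 := μ.measurePreserving_homeomorphUnitSphereProd.symm
    (homeomorphUnitSphereProd E).toMeasurableEquiv
  have h3 := h2.lintegral_comp (f := fun x : ({(0)}ᶜ : Set E) => F x)
    (hF.comp measurable_subtype_coe)
  rw [h1, ← h3, lintegral_prod]
  · rfl
  · exact ((hF.comp measurable_subtype_coe).comp h2.measurable).aemeasurable

/-- Exchanging the directions of `q` and `|q| σ` preserves the measure `dq dσ`. -/
lemma lintegral_sphere_swap (μ : Measure E) [μ.IsAddHaarMeasure] {G : E × E → ℝ≥0∞}
    (hG : Measurable G) :
    ∫⁻ q, ∫⁻ σ : Metric.sphere (0 : E) 1, G (‖q‖ • (σ : E), ‖q‖⁻¹ • q) ∂μ.toSphere ∂μ =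
      ∫⁻ q, ∫⁻ σ : Metric.sphere (0 : E) 1, G (q, σ) ∂μ.toSphere ∂μ := by
  have hm1 : Measurable fun q => ∫⁻ σ : Metric.sphere (0 : E) 1,
      G (‖q‖ • (σ : E), ‖q‖⁻¹ • q) ∂μ.toSphere := by
    refine Measurable.lintegral_prod_right' (f := fun p : E × Metric.sphere (0 : E) 1 =>
      G (‖p.1‖ • (p.2 : E), ‖p.1‖⁻¹ • p.1)) (hG.comp ?_)
    fun_prop
  have hm2 : Measurable fun q => ∫⁻ σ : Metric.sphere (0 : E) 1, G (q, σ) ∂μ.toSphere := by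
    refine Measurable.lintegral_prod_right' (f := fun p : E × Metric.sphere (0 : E) 1 =>
      G (p.1, p.2)) (hG.comp ?_)
    fun_prop
  -- With `q = s ω`, the integrands become `G (s σ, ω)` and `G (s ω, σ)`: the same triple integral
  -- up to renaming `ω` and `σ`, so only Tonelli remains.
  rw [lintegral_polar μ hm1, lintegral_polar μ hm2]
  have hn : ∀ (ω : Metric.sphere (0 : E) 1) (s : Set.Ioi (0 : ℝ)), ‖(s : ℝ) • (ω : E)‖ = s := by
    intro ω s
    have h0 : (0 : ℝ) < s := s.2
    rw [norm_smul, norm_eq_of_mem_sphere, mul_one, Real.norm_of_nonneg h0.le]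
  have hs : ∀ (ω : Metric.sphere (0 : E) 1) (s : Set.Ioi (0 : ℝ)),
      (s : ℝ)⁻¹ • (s : ℝ) • (ω : E) = ω := by
    intro ω s
    have h0 : (0 : ℝ) < s := s.2
    rw [inv_smul_smul₀ h0.ne']
  simp_rw [hn, hs]
  have hmeas : Measurable fun p : (Metric.sphere (0 : E) 1 × Set.Ioi (0 : ℝ)) ×
      Metric.sphere (0 : E) 1 => G ((p.1.2 : ℝ) • (p.2 : E), p.1.1) := by
    refine hG.comp ?_
    fun_prop
  have hL : ∀ ω : Metric.sphere (0 : E) 1, ∫⁻ s : Set.Ioi (0 : ℝ),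
      ∫⁻ σ : Metric.sphere (0 : E) 1, G ((s : ℝ) • (σ : E), ω) ∂μ.toSphere
        ∂Measure.volumeIoiPow (Module.finrank ℝ E - 1) =
      ∫⁻ σ : Metric.sphere (0 : E) 1, ∫⁻ s : Set.Ioi (0 : ℝ),
        G ((s : ℝ) • (σ : E), ω) ∂Measure.volumeIoiPow (Module.finrank ℝ E - 1) ∂μ.toSphere := by
    intro ω
    refine lintegral_lintegral_swap (Measurable.aemeasurable ?_)
    exact hG.comp (by fun_prop)
  have hR : ∀ ω : Metric.sphere (0 : E) 1, ∫⁻ s : Set.Ioi (0 : ℝ),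
      ∫⁻ σ : Metric.sphere (0 : E) 1, G ((s : ℝ) • (ω : E), σ) ∂μ.toSphere
        ∂Measure.volumeIoiPow (Module.finrank ℝ E - 1) =
      ∫⁻ σ : Metric.sphere (0 : E) 1, ∫⁻ s : Set.Ioi (0 : ℝ),
        G ((s : ℝ) • (ω : E), σ) ∂Measure.volumeIoiPow (Module.finrank ℝ E - 1) ∂μ.toSphere := by
    intro ω
    refine lintegral_lintegral_swap (Measurable.aemeasurable ?_)
    exact hG.comp (by fun_prop)
  simp_rw [hL, hR]
  refine lintegral_lintegral_swap (Measurable.aemeasurable ?_)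
  refine Measurable.lintegral_prod_right' (f := fun p : (Metric.sphere (0 : E) 1 ×
    Metric.sphere (0 : E) 1) × Set.Ioi (0 : ℝ) => G ((p.2 : ℝ) • (p.1.2 : E), p.1.1)) (hG.comp ?_)
  fun_prop

end Polar

/-! ### Integrals over a ball of `ℝ^d` compared with integrals over the torus. -/

section Cover

lemma continuous_toTorus {d : ℕ} : Continuous (toTorus (d := d)) := by
  unfold toTorus
  refine continuous_pi fun i => ?_
  exact (AddCircle.continuous_mk' (2 * π)).comp (by fun_prop)

@[fun_prop]
lemma measurable_toTorus {d : ℕ} : Measurable (toTorus (d := d)) := continuous_toTorus.measurable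

lemma toTorus_sub {d : ℕ} (x y : Velocity d) : toTorus (x - y) = toTorus x - toTorus y := by
  ext i
  simp [toTorus]

/-- A box with all sides of length `2π` maps onto the torus preserving the measure. -/
lemma measurePreserving_box {d : ℕ} (a : Fin d → ℝ) :
    MeasurePreserving (fun x : Fin d → ℝ => (fun i => ((x i : ℝ) : AddCircle (2 * π))))
      (volume.restrict (Set.univ.pi fun i => Set.Ioc (a i) (a i + 2 * π))) volume := by
  have := measurePreserving_pi _ _ (fun i => AddCircle.measurePreserving_mk (2 * π) (a i))
  rwa [← Measure.restrict_pi_pi] at this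

instance isNegInvariant_torus (d : ℕ) : (volume : Measure (Torus d)).IsNegInvariant := by
  have : (volume : Measure (AddCircle (2 * π))).IsNegInvariant :=
    Measure.IsAddHaarMeasure.isNegInvariant_of_regular _
  exact Measure.pi.isNegInvariant _

/-- The ball is covered by finitely many boxes of side `2π`, each of which contributes exactly one
integral over the torus. The constant is the number of boxes. -/
lemma exists_lintegral_ball_le (d : ℕ) (R : ℝ) :
    ∃ A : ℝ≥0, ∀ u : Torus d → ℝ≥0∞, Measurable u → ∀ v : Torus d,
      ∫⁻ q in Metric.ball (0 : Velocity d) (2 * R), u (v - toTorus q) ≤ A * ∫⁻ x, u x := by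
  obtain ⟨m, hm⟩ := exists_nat_ge (2 * R)
  -- The boxes are open on the left, so the index of `x` is `⌈x / 2π⌉ - 1`; this is where the extra
  -- `-1` at the lower end comes from.
  let S : Finset (Fin d → ℤ) := Fintype.piFinset fun _ => Finset.Icc (-(m : ℤ) - 1) m
  let box : (Fin d → ℤ) → Set (Fin d → ℝ) := fun k =>
    Set.univ.pi fun i => Set.Ioc (2 * π * k i) (2 * π * k i + 2 * π)
  refine ⟨S.card, fun u hu v => ?_⟩
  have h1 : ∫⁻ q in Metric.ball (0 : Velocity d) (2 * R), u (v - toTorus q) ≤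
      ∫⁻ x in ⋃ k : S, box k, u (v - fun i => ((x i : ℝ) : AddCircle (2 * π))) := by
    have hmp := EuclideanSpace.volume_preserving_symm_measurableEquiv_toLp (Fin d)
    rw [← hmp.setLIntegral_comp_preimage_emb (MeasurableEquiv.measurableEmbedding _)]
    refine lintegral_mono_set fun x hx => ?_
    rw [Set.mem_preimage, Set.mem_iUnion]
    have hx' : ∀ i, |x.ofLp i| ≤ m := fun i => by
      have h := PiLp.norm_apply_le x i
      rw [mem_ball_zero_iff] at hx
      rw [Real.norm_eq_abs] at h
      linarith
    have hpi : (1 : ℝ) ≤ 2 * π := by linarith [Real.pi_gt_three]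
    have hk : ∀ i, 2 * π * ((⌈x.ofLp i / (2 * π)⌉ - 1 : ℤ) : ℝ) < x.ofLp i ∧
        x.ofLp i ≤ 2 * π * ((⌈x.ofLp i / (2 * π)⌉ - 1 : ℤ) : ℝ) + 2 * π := fun i => by
      have h1 := Int.ceil_lt_add_one (x.ofLp i / (2 * π))
      have h2 := Int.le_ceil (x.ofLp i / (2 * π))
      rw [div_le_iff₀ (by positivity)] at h2
      have h3 : (⌈x.ofLp i / (2 * π)⌉ : ℝ) - 1 < x.ofLp i / (2 * π) := by linarith
      rw [lt_div_iff₀ (by positivity)] at h3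
      push_cast
      exact ⟨by linarith, by linarith⟩
    refine ⟨⟨fun i => ⌈x.ofLp i / (2 * π)⌉ - 1, ?_⟩, fun i _ => hk i⟩
    refine Fintype.mem_piFinset.2 fun i => ?_
    have hdiv : |x.ofLp i / (2 * π)| ≤ m := by
      rw [abs_div, abs_of_pos (by positivity : 0 < 2 * π), div_le_iff₀ (by positivity)]
      nlinarith [hx' i, abs_nonneg (x.ofLp i)]
    rw [abs_le] at hdiv
    have h2 : ⌈x.ofLp i / (2 * π)⌉ ≤ m := Int.ceil_le.2 (by exact_mod_cast hdiv.2)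
    have h3 : -(m : ℤ) ≤ ⌈x.ofLp i / (2 * π)⌉ := by
      have : ((-(m : ℤ) : ℤ) : ℝ) ≤ (⌈x.ofLp i / (2 * π)⌉ : ℝ) := by
        push_cast
        exact hdiv.1.trans (Int.le_ceil _)
      exact_mod_cast this
    rw [Finset.mem_Icc]
    omega
  refine h1.trans ((lintegral_iUnion_le _ _).trans ?_)
  have h2 : ∀ k : S, ∫⁻ x in box k, u (v - fun i => ((x i : ℝ) : AddCircle (2 * π))) =
      ∫⁻ x, u x := by
    intro k
    have hmp := measurePreserving_box (d := d) fun i => 2 * π * k.1 i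
    rw [← lintegral_sub_left_eq_self u v]
    exact hmp.lintegral_comp (f := fun w => u (v - w)) (hu.comp (measurable_const.sub measurable_id))
  simp_rw [h2, tsum_fintype]
  simp

end Cover

/-! ### The `L²` estimate for the collision integral in absolute values. -/

/-- Cauchy-Schwarz for the measure `b dμ`, obtained from the factorization `b x = b^{1/2} · (b^{1/2}
x)`. -/
lemma sq_lintegral_mul_le {α : Type*} [MeasurableSpace α] {μ : Measure α} {b x : α → ℝ≥0∞}
    (hb : AEMeasurable b μ) (hx : AEMeasurable x μ) :
    (∫⁻ a, b a * x a ∂μ) ^ 2 ≤ (∫⁻ a, b a ∂μ) * ∫⁻ a, b a * x a ^ 2 ∂μ := by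
  have h := ENNReal.lintegral_mul_le_Lp_mul_Lq μ Real.HolderConjugate.two_two
    (hb.pow_const (1 / 2 : ℝ)) ((hb.pow_const (1 / 2 : ℝ)).mul hx)
  have hsq : ∀ y : ℝ≥0∞, (y ^ (1 / 2 : ℝ)) ^ (2 : ℝ) = y := fun y => by
    rw [← ENNReal.rpow_mul]; norm_num
  have hmul : ∀ y : ℝ≥0∞, y ^ (1 / 2 : ℝ) * y ^ (1 / 2 : ℝ) = y := fun y => by
    rw [← ENNReal.rpow_add_of_nonneg _ _ (by norm_num) (by norm_num)]; norm_num
  simp only [Pi.mul_apply, ← mul_assoc, hmul, ENNReal.mul_rpow_of_nonneg _ _ zero_le_two, hsq] at h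
  calc (∫⁻ a, b a * x a ∂μ) ^ 2 ≤ _ := pow_le_pow_left' h 2
    _ = _ := by
      rw [mul_pow, ← ENNReal.rpow_natCast, ← ENNReal.rpow_natCast, Nat.cast_ofNat, hsq, hsq]
      simp

/-- The domain `B_0(2R) × S^{d-1}` with the measure `dq dσ`. -/
noncomputable def collisionMeasure (d : ℕ) (R : ℝ) :
    Measure (Velocity d × Metric.sphere (0 : Velocity d) 1) :=
  (volume.restrict (Metric.ball (0 : Velocity d) (2 * R))).prod
    (volume : Measure (Velocity d)).toSphere

instance sFinite_collisionMeasure (d : ℕ) (R : ℝ) : SFinite (collisionMeasure d R) :=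
  have : IsFiniteMeasure (volume : Measure (Velocity d)).toSphere := inferInstance
  Measure.prod.instSFinite

/-- The collision kernel as a function of `(q, σ)`. -/
noncomputable def kernel {d : ℕ} (B : ℝ → ℝ → ℝ)
    (p : Velocity d × Metric.sphere (0 : Velocity d) 1) : ℝ :=
  B ‖p.1‖ (inner ℝ (‖p.1‖⁻¹ • p.1) (p.2 : Velocity d))

/-- The displacement `v - v'_*`. -/
noncomputable def shiftStar {d : ℕ} (p : Velocity d × Metric.sphere (0 : Velocity d) 1) :
    Torus d :=
  toTorus ((1 / 2 : ℝ) • (p.1 + ‖p.1‖ • (p.2 : Velocity d)))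

/-- The displacement `v - v'`. -/
noncomputable def shiftPrime {d : ℕ} (p : Velocity d × Metric.sphere (0 : Velocity d) 1) :
    Torus d :=
  toTorus ((1 / 2 : ℝ) • (p.1 - ‖p.1‖ • (p.2 : Velocity d)))

@[fun_prop]
lemma measurable_shiftStar {d : ℕ} : Measurable (shiftStar (d := d)) :=
  measurable_toTorus.comp (by fun_prop)

@[fun_prop]
lemma measurable_shiftPrime {d : ℕ} : Measurable (shiftPrime (d := d)) :=
  measurable_toTorus.comp (by fun_prop)

/-- Seen from `v'`, the partner is `v'_* = v' - |q| σ`: the gain term is a loss term with relative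
velocity `|q| σ`. -/
lemma shiftStar_sub_shiftPrime {d : ℕ} (p : Velocity d × Metric.sphere (0 : Velocity d) 1) :
    shiftStar p - shiftPrime p = toTorus (‖p.1‖ • (p.2 : Velocity d)) := by
  rw [shiftStar, shiftPrime, ← toTorus_sub]
  congr 1
  module

variable {d : ℕ} {R : ℝ} {B : ℝ → ℝ → ℝ}


lemma measurable_kernel (hB : IsAdmissibleKernel d R B) : Measurable (kernel (d := d) B) := by
  refine hB.measurable.comp (f := fun p : Velocity d × Metric.sphere (0 : Velocity d) 1 =>
    (‖p.1‖, inner ℝ (‖p.1‖⁻¹ • p.1) (p.2 : Velocity d))) ?_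
  fun_prop

lemma nontrivial_velocity (hd : 1 ≤ d) : Nontrivial (Velocity d) := by
  have : Nonempty (Fin d) := ⟨⟨0, hd⟩⟩
  infer_instance

lemma ae_ne_zero (hd : 1 ≤ d) : ∀ᵐ q : Velocity d, q ≠ 0 := by
  have := nontrivial_velocity hd
  exact Measure.ae_ne volume 0

/-- For fixed `q ≠ 0` the integral over `σ` is the total cross section in the direction `e = q /
|q|`, which is bounded by assumption. -/
lemma exists_lintegral_kernel_le (hd : 1 ≤ d) (hB : IsAdmissibleKernel d R B) :
    ∃ M : ℝ≥0, ∀ u : Velocity d → ℝ≥0∞, Measurable u →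
      ∫⁻ p, ENNReal.ofReal (kernel B p) * u p.1 ∂collisionMeasure d R ≤
        M * ∫⁻ q in Metric.ball (0 : Velocity d) (2 * R), u q := by
  obtain ⟨M, hM⟩ := hB.bounded
  refine ⟨M, fun u hu => ?_⟩
  have hk := measurable_kernel hB
  rw [collisionMeasure, lintegral_prod _ (by fun_prop), ← lintegral_const_mul _ hu]
  refine lintegral_mono_ae ?_
  filter_upwards [ae_restrict_of_ae (ae_ne_zero hd), ae_restrict_mem measurableSet_ball] with q h0 hq
  rw [lintegral_mul_const _ (by fun_prop)]
  gcongr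
  have hn : 0 < ‖q‖ := norm_pos_iff.2 h0
  rw [mem_ball_zero_iff] at hq
  exact hM ‖q‖ hn hq.le ⟨‖q‖⁻¹ • q, by
    rw [mem_sphere_zero_iff_norm, norm_smul, norm_inv, norm_norm, inv_mul_cancel₀ hn.ne']⟩

lemma exists_lintegral_loss_le (hd : 1 ≤ d) (hB : IsAdmissibleKernel d R B) :
    ∃ A : ℝ≥0, ∀ u w : Torus d → ℝ≥0∞, Measurable u → Measurable w →
      ∫⁻ v, ∫⁻ p, ENNReal.ofReal (kernel B p) * (u (v - toTorus p.1) * w v)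
        ∂collisionMeasure d R ≤ A * ((∫⁻ v, u v) * ∫⁻ v, w v) := by
  obtain ⟨M, hM⟩ := exists_lintegral_kernel_le hd hB
  obtain ⟨A, hA⟩ := exists_lintegral_ball_le d R
  refine ⟨M * A, fun u w hu hw => ?_⟩
  calc _ ≤ ∫⁻ v, (M * A * ∫⁻ x, u x) * w v := by
        refine lintegral_mono fun v => ?_
        refine (hM (fun q => u (v - toTorus q) * w v) (by fun_prop)).trans ?_
        rw [lintegral_mul_const _ (by fun_prop), mul_assoc (M : ℝ≥0∞), mul_assoc (M : ℝ≥0∞)]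
        gcongr
        exact hA u hu v
    _ = _ := by
        rw [lintegral_const_mul _ hw]
        push_cast
        ring

/-- The change between pre- and post-collisional velocities. -/
lemma lintegral_gain_eq_loss (hd : 1 ≤ d) (hB : IsAdmissibleKernel d R B)
    {u w : Torus d → ℝ≥0∞} (hu : Measurable u) (hw : Measurable w) :
    ∫⁻ v, ∫⁻ p, ENNReal.ofReal (kernel B p) * (u (v - shiftStar p) * w (v - shiftPrime p))
        ∂collisionMeasure d R =
      ∫⁻ v, ∫⁻ p, ENNReal.ofReal (kernel B p) * (u (v - toTorus p.1) * w v)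
        ∂collisionMeasure d R := by
  have := nontrivial_velocity hd
  have hk := measurable_kernel hB
  rw [lintegral_lintegral_swap (Measurable.aemeasurable (by fun_prop))]
  -- The kernel does not depend on `v`, so for fixed `(q, σ)` translating `v` by `shiftPrime p`
  -- moves `v'` to `v` and `v'_*` to `v - |q| σ`.
  have h1 : ∀ p : Velocity d × Metric.sphere (0 : Velocity d) 1,
      ∫⁻ v, ENNReal.ofReal (kernel B p) * (u (v - shiftStar p) * w (v - shiftPrime p)) =
      ∫⁻ v, ENNReal.ofReal (kernel B p) *
        (u (v - toTorus (‖p.1‖ • (p.2 : Velocity d))) * w v) := by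
    intro p
    rw [← lintegral_sub_right_eq_self (fun v => ENNReal.ofReal (kernel B p) *
        (u (v - toTorus (‖p.1‖ • (p.2 : Velocity d))) * w v)) (shiftPrime p)]
    simp_rw [← shiftStar_sub_shiftPrime, sub_sub_sub_cancel_right]
  simp_rw [h1]
  rw [← lintegral_lintegral_swap (Measurable.aemeasurable (by fun_prop))]
  refine lintegral_congr fun v => ?_
  -- It remains to exchange `|q| σ` with `q`. The exchange lemma integrates over the whole space, so
  -- the ball enters through an indicator.
  let S : Set (Velocity d) := Metric.ball 0 (2 * R)
  let G : Velocity d × Velocity d → ℝ≥0∞ := fun x => S.indicator (fun q =>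
    ENNReal.ofReal (B ‖q‖ (inner ℝ (‖q‖⁻¹ • q) x.2)) * (u (v - toTorus q) * w v)) x.1
  have hG : Measurable G := by
    have : G = (Prod.fst ⁻¹' S).indicator fun x =>
        ENNReal.ofReal (B ‖x.1‖ (inner ℝ (‖x.1‖⁻¹ • x.1) x.2)) * (u (v - toTorus x.1) * w v) := by
      ext x
      by_cases hx : x.1 ∈ S <;> simp [G, hx]
    rw [this]
    refine Measurable.indicator ?_ (measurable_fst measurableSet_ball)
    have : Measurable fun x : Velocity d × Velocity d => B ‖x.1‖ (inner ℝ (‖x.1‖⁻¹ • x.1) x.2) :=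
      hB.measurable.comp (f := fun x : Velocity d × Velocity d =>
        (‖x.1‖, inner ℝ (‖x.1‖⁻¹ • x.1) x.2)) (by fun_prop)
    exact this.ennreal_ofReal.mul (by fun_prop)
  have hswap := lintegral_sphere_swap (volume : Measure (Velocity d)) hG
  rw [collisionMeasure, lintegral_prod _ (by fun_prop), lintegral_prod _ (by fun_prop),
    ← lintegral_indicator measurableSet_ball, ← lintegral_indicator measurableSet_ball]
  convert hswap using 1
  · refine lintegral_congr_ae ?_
    filter_upwards [ae_ne_zero hd] with q hq
    have hn : ‖q‖ ≠ 0 := norm_ne_zero_iff.2 hq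
    have hσ : ∀ σ : Metric.sphere (0 : Velocity d) 1, ‖‖q‖ • (σ : Velocity d)‖ = ‖q‖ := by
      intro σ
      rw [norm_smul, norm_norm, norm_eq_of_mem_sphere, mul_one]
    by_cases hqS : q ∈ S
    · rw [Set.indicator_of_mem hqS]
      refine lintegral_congr fun σ => ?_
      have : ‖q‖ • (σ : Velocity d) ∈ S := by
        rw [mem_ball_zero_iff, hσ]; exact mem_ball_zero_iff.1 hqS
      simp only [G, Set.indicator_of_mem this, hσ, inv_smul_smul₀ hn, kernel]
      -- The exchange preserves `|q|` and turns `(q/|q|) · σ` into `σ · (q/|q|)`, so the kernel is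
      -- unchanged.
      rw [real_inner_comm]
    · rw [Set.indicator_of_notMem hqS]
      have : ∀ σ : Metric.sphere (0 : Velocity d) 1, ‖q‖ • (σ : Velocity d) ∉ S := by
        intro σ h
        rw [mem_ball_zero_iff, hσ] at h
        exact hqS (mem_ball_zero_iff.2 h)
      simp [G, this]
  · refine lintegral_congr fun q => ?_
    by_cases hqS : q ∈ S
    · rw [Set.indicator_of_mem hqS]
      simp only [G, Set.indicator_of_mem hqS, kernel]
    · rw [Set.indicator_of_notMem hqS]
      simp [G, hqS]

/-- The collision integral with all terms counted positively. -/
noncomputable def collisionBound (B : ℝ → ℝ → ℝ) (R : ℝ) (u w : Torus d → ℝ≥0∞) (v : Torus d) :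
    ℝ≥0∞ :=
  ∫⁻ p, ENNReal.ofReal (kernel B p) *
    (u (v - shiftStar p) * w (v - shiftPrime p) + u (v - toTorus p.1) * w v) ∂collisionMeasure d R

lemma exists_lintegral_collisionBound_sq_le (hd : 1 ≤ d) (hB : IsAdmissibleKernel d R B) :
    ∃ A : ℝ≥0, ∀ u w : Torus d → ℝ≥0∞, Measurable u → Measurable w →
      ∫⁻ v, collisionBound B R u w v ^ 2 ≤ A * ((∫⁻ v, u v ^ 2) * ∫⁻ v, w v ^ 2) := by
  obtain ⟨M, hM⟩ := exists_lintegral_kernel_le hd hB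
  obtain ⟨A, hA⟩ := exists_lintegral_loss_le hd hB
  have hk := measurable_kernel hB
  let M' : ℝ≥0 := M * (volume (Metric.ball (0 : Velocity d) (2 * R))).toNNReal
  have hM' : ∫⁻ p, ENNReal.ofReal (kernel B p) ∂collisionMeasure d R ≤ M' := by
    have := hM (fun _ => 1) measurable_const
    simp only [mul_one, lintegral_const, MeasurableSet.univ, Measure.restrict_apply, Set.univ_inter,
      one_mul] at this
    rw [ENNReal.coe_mul, ENNReal.coe_toNNReal measure_ball_lt_top.ne]
    exact this
  refine ⟨M' * (4 * A), fun u w hu hw => ?_⟩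
  let X : Torus d → ℝ≥0∞ := fun v => ∫⁻ p, ENNReal.ofReal (kernel B p) *
    ((u (v - shiftStar p)) ^ 2 * (w (v - shiftPrime p)) ^ 2) ∂collisionMeasure d R
  let Y : Torus d → ℝ≥0∞ := fun v => ∫⁻ p, ENNReal.ofReal (kernel B p) *
    ((u (v - toTorus p.1)) ^ 2 * (w v) ^ 2) ∂collisionMeasure d R
  have hX : Measurable X := Measurable.lintegral_prod_right (by fun_prop)
  have hY : Measurable Y := Measurable.lintegral_prod_right (by fun_prop)
  have hXY : ∫⁻ v, X v = ∫⁻ v, Y v :=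
    lintegral_gain_eq_loss hd hB (hu.pow_const 2) (hw.pow_const 2)
  have hYA : ∫⁻ v, Y v ≤ A * ((∫⁻ v, u v ^ 2) * ∫⁻ v, w v ^ 2) :=
    hA _ _ (hu.pow_const 2) (hw.pow_const 2)
  -- Cauchy-Schwarz against the kernel, whose total mass is at most `M'`, followed by `(a + b)² ≤
  -- 2a² + 2b²`. Since `X` and `Y` have equal integrals, this produces the factor `4`.
  have hpt : ∀ v, collisionBound B R u w v ^ 2 ≤ M' * (2 * X v + 2 * Y v) := by
    intro v
    refine (sq_lintegral_mul_le hk.ennreal_ofReal.aemeasurable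
      (Measurable.aemeasurable (by fun_prop))).trans ?_
    refine mul_le_mul' hM' ?_
    rw [← lintegral_const_mul _ (by fun_prop), ← lintegral_const_mul _ (by fun_prop),
      ← lintegral_add_left (by fun_prop)]
    refine lintegral_mono fun p => ?_
    have h2 : ∀ a b : ℝ≥0∞, (a + b) ^ 2 ≤ 2 * a ^ 2 + 2 * b ^ 2 := by
      intro a b
      have := ENNReal.rpow_add_le_mul_rpow_add_rpow a b (p := 2) (by norm_num)
      norm_num at this
      rwa [mul_add] at this
    calc _ ≤ ENNReal.ofReal (kernel B p) * _ := mul_le_mul_right (h2 _ _) _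
      _ = _ := by ring
  calc _ ≤ ∫⁻ v, M' * (2 * X v + 2 * Y v) := lintegral_mono hpt
    _ = M' * (2 * (∫⁻ v, X v) + 2 * ∫⁻ v, Y v) := by
      rw [lintegral_const_mul _ (by fun_prop), lintegral_add_left (by fun_prop),
        lintegral_const_mul _ hX, lintegral_const_mul _ hY]
    _ = M' * (4 * ∫⁻ v, Y v) := by rw [hXY]; ring
    _ ≤ M' * (4 * (A * ((∫⁻ v, u v ^ 2) * ∫⁻ v, w v ^ 2))) := by gcongr
    _ = _ := by push_cast; ring

/-- For each fixed parameter the map is a translation, so preimages of null sets are null. Changing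
`f` on a null set is therefore harmless, and shifted functions stay jointly a.e. measurable. -/
lemma quasiMeasurePreserving_sub_shift {α : Type*} [MeasurableSpace α] (ν : Measure α) [SFinite ν]
    {T : α → Torus d} (hT : Measurable T) :
    Measure.QuasiMeasurePreserving (fun x : Torus d × α => x.1 - T x.2)
      ((volume : Measure (Torus d)).prod ν) volume := by
  refine ⟨by fun_prop, Measure.AbsolutelyContinuous.mk fun s hs h0 => ?_⟩
  rw [Measure.map_apply (by fun_prop) hs, Measure.prod_apply_symm (hs.preimage (by fun_prop))]
  refine lintegral_eq_zero_of_ae_eq_zero (Filter.Eventually.of_forall fun p => ?_)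
  exact ((measurePreserving_sub_right volume (T p)).measure_preimage hs.nullMeasurableSet).trans h0

lemma aestronglyMeasurable_comp_sub_shift {α β : Type*} [MeasurableSpace α] [TopologicalSpace β]
    {ν : Measure α} [SFinite ν] {T : α → Torus d} (hT : Measurable T) {f : Torus d → β}
    (hf : AEStronglyMeasurable f volume) :
    AEStronglyMeasurable (fun x : Torus d × α => f (x.1 - T x.2))
      ((volume : Measure (Torus d)).prod ν) :=
  hf.comp_quasiMeasurePreserving (quasiMeasurePreserving_sub_shift ν hT)

lemma collisionBound_congr_ae {u u' w w' : Torus d → ℝ≥0∞} (hu : u =ᵐ[volume] u')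
    (hw : w =ᵐ[volume] w') :
    collisionBound B R u w =ᵐ[volume] collisionBound B R u' w' := by
  have key : ∀ {T : Velocity d × Metric.sphere (0 : Velocity d) 1 → Torus d} {g g' : Torus d → ℝ≥0∞},
      Measurable T → g =ᵐ[volume] g' →
      ∀ᵐ v, ∀ᵐ p ∂collisionMeasure d R, g (v - T p) = g' (v - T p) := by
    intro T g g' hT hg
    exact Measure.ae_ae_of_ae_prod
      ((quasiMeasurePreserving_sub_shift (collisionMeasure d R) hT).ae hg)
  filter_upwards [key measurable_shiftStar hu, key measurable_shiftPrime hw,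
    key (T := fun p => toTorus p.1) (by fun_prop) hu, hw] with v h1 h2 h3 h4
  refine lintegral_congr_ae ?_
  filter_upwards [h1, h2, h3] with p h1 h2 h3
  rw [h1, h2, h3, h4]

lemma measurable_collisionBound (hB : IsAdmissibleKernel d R B) {u w : Torus d → ℝ≥0∞}
    (hu : Measurable u) (hw : Measurable w) : Measurable (collisionBound B R u w) := by
  have hk := measurable_kernel hB
  exact Measurable.lintegral_prod_right (by fun_prop)

lemma aemeasurable_collisionBound (hB : IsAdmissibleKernel d R B) {u w : Torus d → ℝ≥0∞}
    (hu : AEMeasurable u) (hw : AEMeasurable w) : AEMeasurable (collisionBound B R u w) :=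
  ⟨_, measurable_collisionBound hB hu.measurable_mk hw.measurable_mk,
    collisionBound_congr_ae hu.ae_eq_mk hw.ae_eq_mk⟩

lemma exists_eLpNorm_collisionBound_le (hd : 1 ≤ d) (hB : IsAdmissibleKernel d R B) :
    ∃ A : ℝ≥0, ∀ f g : Torus d → ℂ, AEStronglyMeasurable f volume →
      AEStronglyMeasurable g volume →
      eLpNorm (collisionBound B R (fun v => ‖f v‖ₑ) (fun v => ‖g v‖ₑ)) 2 volume ≤
        A * (eLpNorm f 2 volume * eLpNorm g 2 volume) := by
  obtain ⟨A, hA⟩ := exists_lintegral_collisionBound_sq_le hd hB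
  refine ⟨A ^ (1 / 2 : ℝ), fun f g hf hg => ?_⟩
  have h := hA _ _ hf.enorm.measurable_mk hg.enorm.measurable_mk
  have hu := hf.enorm.ae_eq_mk
  have hw := hg.enorm.ae_eq_mk
  have h1 : ∫⁻ v, collisionBound B R (hf.enorm.mk _) (hg.enorm.mk _) v ^ 2 =
      ∫⁻ v, collisionBound B R (fun v => ‖f v‖ₑ) (fun v => ‖g v‖ₑ) v ^ 2 := by
    refine lintegral_congr_ae ?_
    filter_upwards [collisionBound_congr_ae (B := B) (R := R) hu hw] with v hv
    rw [hv]
  have h2 : ∫⁻ v, hf.enorm.mk _ v ^ 2 = ∫⁻ v, ‖f v‖ₑ ^ 2 := by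
    refine lintegral_congr_ae ?_
    filter_upwards [hu] with v hv
    rw [hv]
  have h3 : ∫⁻ v, hg.enorm.mk _ v ^ 2 = ∫⁻ v, ‖g v‖ₑ ^ 2 := by
    refine lintegral_congr_ae ?_
    filter_upwards [hw] with v hv
    rw [hv]
  rw [h1, h2, h3] at h
  have hp : ∀ {ε : Type} [ENorm ε] (F : Torus d → ε),
      eLpNorm F 2 volume = (∫⁻ v, ‖F v‖ₑ ^ 2) ^ (1 / 2 : ℝ) := by
    intro ε _ F
    rw [eLpNorm_eq_lintegral_rpow_enorm_toReal two_ne_zero ENNReal.ofNat_ne_top]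
    simp
  rw [hp, hp, hp, ENNReal.coe_rpow_of_nonneg _ (by norm_num),
    ← ENNReal.mul_rpow_of_nonneg _ _ (by norm_num), ← ENNReal.mul_rpow_of_nonneg _ _ (by norm_num)]
  exact ENNReal.rpow_le_rpow h (by norm_num)

/-! ### The collision operator on `L²`: measurability, integrability, Lipschitz bound. -/

/-- The integrand of the collision operator. -/
noncomputable def collisionIntegrand (B : ℝ → ℝ → ℝ) (f g : Torus d → ℂ) (v : Torus d)
    (p : Velocity d × Metric.sphere (0 : Velocity d) 1) : ℂ :=
  (kernel B p : ℂ) * (f (v - shiftStar p) * g (v - shiftPrime p) - f (v - toTorus p.1) * g v)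

lemma collision_eq (f g : Torus d → ℂ) (v : Torus d) :
    collision B R f g v = ∫ p, collisionIntegrand B f g v p ∂collisionMeasure d R := rfl

lemma aestronglyMeasurable_collisionIntegrand (hB : IsAdmissibleKernel d R B) {f g : Torus d → ℂ}
    (hf : AEStronglyMeasurable f volume) (hg : AEStronglyMeasurable g volume) :
    AEStronglyMeasurable (Function.uncurry (collisionIntegrand B f g))
      ((volume : Measure (Torus d)).prod (collisionMeasure d R)) := by
  have hk : AEStronglyMeasurable
      (fun x : Torus d × (Velocity d × Metric.sphere (0 : Velocity d) 1) => (kernel B x.2 : ℂ))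
      ((volume : Measure (Torus d)).prod (collisionMeasure d R)) :=
    (Complex.measurable_ofReal.comp
      ((measurable_kernel hB).comp measurable_snd)).aestronglyMeasurable
  have h1 := aestronglyMeasurable_comp_sub_shift (ν := collisionMeasure d R)
    measurable_shiftStar hf
  have h2 := aestronglyMeasurable_comp_sub_shift (ν := collisionMeasure d R)
    measurable_shiftPrime hg
  have h3 := aestronglyMeasurable_comp_sub_shift (ν := collisionMeasure d R)
    (T := fun p => toTorus p.1) (by fun_prop) hf
  have h4 : AEStronglyMeasurable
      (fun x : Torus d × (Velocity d × Metric.sphere (0 : Velocity d) 1) => g x.1)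
      ((volume : Measure (Torus d)).prod (collisionMeasure d R)) := hg.comp_fst
  have h5 := (h1.mul h2).sub (h3.mul h4)
  exact hk.mul h5

lemma aestronglyMeasurable_collision (hB : IsAdmissibleKernel d R B) {f g : Torus d → ℂ}
    (hf : AEStronglyMeasurable f volume) (hg : AEStronglyMeasurable g volume) :
    AEStronglyMeasurable (collision B R f g) volume :=
  (aestronglyMeasurable_collisionIntegrand hB hf hg).integral_prod_right'

lemma lintegral_enorm_collisionIntegrand_le (hB : IsAdmissibleKernel d R B) (f g : Torus d → ℂ)
    (v : Torus d) :
    ∫⁻ p, ‖collisionIntegrand B f g v p‖ₑ ∂collisionMeasure d R ≤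
      collisionBound B R (fun v => ‖f v‖ₑ) (fun v => ‖g v‖ₑ) v := by
  refine lintegral_mono fun p => ?_
  rw [collisionIntegrand, enorm_mul]
  have h1 : ‖(kernel B p : ℂ)‖ₑ = ENNReal.ofReal (kernel B p) := by
    rw [← ofReal_norm, Complex.norm_real, Real.norm_of_nonneg (show 0 ≤ kernel B p from hB.nonneg _ _)]
  rw [h1]
  gcongr
  refine (enorm_sub_le).trans ?_
  rw [enorm_mul, enorm_mul]

lemma enorm_collision_le (hB : IsAdmissibleKernel d R B) (f g : Torus d → ℂ) (v : Torus d) :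
    ‖collision B R f g v‖ₑ ≤ collisionBound B R (fun v => ‖f v‖ₑ) (fun v => ‖g v‖ₑ) v := by
  rw [collision_eq]
  exact (enorm_integral_le_lintegral_enorm _).trans
    (lintegral_enorm_collisionIntegrand_le hB f g v)

/-- Bilinearity of the collision operator, in the form of a difference of squares. -/
lemma collision_sub_collision {f h : Torus d → ℂ} {v : Torus d}
    (h1 : Integrable (collisionIntegrand B f f v) (collisionMeasure d R))
    (h2 : Integrable (collisionIntegrand B h h v) (collisionMeasure d R))
    (h3 : Integrable (collisionIntegrand B (f - h) f v) (collisionMeasure d R))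
    (h4 : Integrable (collisionIntegrand B h (f - h) v) (collisionMeasure d R)) :
    collision B R f f v - collision B R h h v =
      collision B R (f - h) f v + collision B R h (f - h) v := by
  rw [collision_eq, collision_eq, collision_eq, collision_eq, ← integral_sub h1 h2,
    ← integral_add h3 h4]
  congr 1 with p
  simp only [collisionIntegrand, Pi.sub_apply]
  ring

lemma memLp_collision (hd : 1 ≤ d) (hB : IsAdmissibleKernel d R B) {f g : Torus d → ℂ}
    (hf : MemLp f 2 volume) (hg : MemLp g 2 volume) : MemLp (collision B R f g) 2 volume := by
  obtain ⟨A, hA⟩ := exists_eLpNorm_collisionBound_le hd hB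
  refine ⟨aestronglyMeasurable_collision hB hf.1 hg.1, ?_⟩
  refine lt_of_le_of_lt (eLpNorm_mono_enorm (g := collisionBound B R (fun v => ‖f v‖ₑ)
    (fun v => ‖g v‖ₑ)) fun v => ?_) ((hA f g hf.1 hg.1).trans_lt ?_)
  · exact enorm_collision_le hB f g v
  · exact ENNReal.mul_lt_top ENNReal.coe_lt_top (ENNReal.mul_lt_top hf.2 hg.2)

/-- A finite `L²` norm makes `collisionBound` finite almost everywhere. Integrability is needed
because the Bochner integral defaults to zero without it, and splitting the integrals could fail. -/
lemma ae_integrable_collisionIntegrand (hd : 1 ≤ d) (hB : IsAdmissibleKernel d R B)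
    {f g : Torus d → ℂ} (hf : MemLp f 2 volume) (hg : MemLp g 2 volume) :
    ∀ᵐ v, Integrable (collisionIntegrand B f g v) (collisionMeasure d R) := by
  obtain ⟨A, hA⟩ := exists_eLpNorm_collisionBound_le hd hB
  have hfin : ∀ᵐ v, collisionBound B R (fun v => ‖f v‖ₑ) (fun v => ‖g v‖ₑ) v < ∞ := by
    have h2 := (hA f g hf.1 hg.1).trans_lt (ENNReal.mul_lt_top ENNReal.coe_lt_top
      (ENNReal.mul_lt_top hf.2 hg.2))
    have h3 := lintegral_rpow_enorm_lt_top_of_eLpNorm_lt_top two_ne_zero ENNReal.ofNat_ne_top h2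
    have hm := aemeasurable_collisionBound (B := B) (R := R) hB hf.1.enorm hg.1.enorm
    filter_upwards [ae_lt_top' (by simpa using hm.pow_const 2) h3.ne] with v hv
    simpa using hv
  filter_upwards [hfin, (aestronglyMeasurable_collisionIntegrand (R := R) hB hf.1 hg.1).prodMk_left]
    with v h1 h2
  exact ⟨h2, (lintegral_enorm_collisionIntegrand_le hB f g v).trans_lt h1⟩

/-- The collision operator is locally Lipschitz continuous on `L²`. -/
lemma exists_eLpNorm_collision_sub_le (hd : 1 ≤ d) (hB : IsAdmissibleKernel d R B) :
    ∃ A : ℝ≥0, ∀ f h : Torus d → ℂ, MemLp f 2 volume → MemLp h 2 volume →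
      eLpNorm (collision B R f f - collision B R h h) 2 volume ≤
        A * ((eLpNorm f 2 volume + eLpNorm h 2 volume) * eLpNorm (f - h) 2 volume) := by
  obtain ⟨A, hA⟩ := exists_eLpNorm_collisionBound_le hd hB
  refine ⟨A, fun f h hf hh => ?_⟩
  have hfh : MemLp (f - h) 2 volume := hf.sub hh
  let D₁ : Torus d → ℝ≥0∞ := collisionBound B R (fun v => ‖(f - h) v‖ₑ) (fun v => ‖f v‖ₑ)
  let D₂ : Torus d → ℝ≥0∞ := collisionBound B R (fun v => ‖h v‖ₑ) (fun v => ‖(f - h) v‖ₑ)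
  have hD₁ : AEStronglyMeasurable D₁ volume :=
    (aemeasurable_collisionBound hB hfh.1.enorm hf.1.enorm).aestronglyMeasurable
  have hD₂ : AEStronglyMeasurable D₂ volume :=
    (aemeasurable_collisionBound hB hh.1.enorm hfh.1.enorm).aestronglyMeasurable
  have hpt : ∀ᵐ v, ‖(collision B R f f - collision B R h h) v‖ₑ ≤ ‖(D₁ + D₂) v‖ₑ := by
    filter_upwards [ae_integrable_collisionIntegrand hd hB hf hf,
      ae_integrable_collisionIntegrand hd hB hh hh,
      ae_integrable_collisionIntegrand hd hB hfh hf,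
      ae_integrable_collisionIntegrand hd hB hh hfh] with v h1 h2 h3 h4
    rw [Pi.sub_apply, collision_sub_collision h1 h2 h3 h4]
    exact (enorm_add_le _ _).trans
      (add_le_add (enorm_collision_le hB _ _ v) (enorm_collision_le hB _ _ v))
  have h1 : eLpNorm D₁ 2 volume ≤ A * (eLpNorm (f - h) 2 volume * eLpNorm f 2 volume) :=
    hA _ _ hfh.1 hf.1
  have h2 : eLpNorm D₂ 2 volume ≤ A * (eLpNorm h 2 volume * eLpNorm (f - h) 2 volume) :=
    hA _ _ hh.1 hfh.1
  calc _ ≤ eLpNorm (D₁ + D₂) 2 volume := eLpNorm_mono_enorm_ae hpt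
    _ ≤ eLpNorm D₁ 2 volume + eLpNorm D₂ 2 volume := eLpNorm_add_le hD₁ hD₂ one_le_two
    _ ≤ _ := add_le_add h1 h2
    _ = _ := by ring

/-! ### Moments and stability of the constrained best approximation. -/

lemma enorm_euclidean_le_sum {ι : Type*} [Fintype ι] (x : EuclideanSpace ℂ ι) :
    ‖x‖ₑ ≤ ∑ i, ‖x i‖ₑ := by
  have h : ‖x‖ ≤ ∑ i, ‖x i‖ := by
    rw [EuclideanSpace.norm_eq, Real.sqrt_le_left (Finset.sum_nonneg fun _ _ => norm_nonneg _)]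
    exact Finset.sum_sq_le_sq_sum_of_nonneg fun _ _ => norm_nonneg _
  simp_rw [← ofReal_norm]
  rw [← ENNReal.ofReal_sum_of_nonneg fun _ _ => norm_nonneg _]
  exact ENNReal.ofReal_le_ofReal h

/-- The collision invariants are bounded on the box and the box has finite volume, so Hölder
suffices. -/
lemma exists_enorm_moments_le (d : ℕ) :
    ∃ A : ℝ≥0, ∀ f : Torus d → ℂ, AEStronglyMeasurable f volume →
      ‖moments f‖ₑ ≤ A * eLpNorm f 2 volume := by
  choose K hK using fun i : MomentIndex d => exists_bound_collisionInvariant i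
  have hK0 : ∀ i, 0 ≤ K i := fun i => (abs_nonneg _).trans (hK i 0)
  let c : ℝ≥0∞ := volume (Set.univ : Set (Torus d)) ^ (1 / (1 : ℝ≥0∞).toReal - 1 / (2 : ℝ≥0∞).toReal)
  have hc : c ≠ ∞ := by
    refine ENNReal.rpow_ne_top_of_nonneg (by norm_num) (measure_ne_top _ _)
  refine ⟨∑ i, (K i).toNNReal * c.toNNReal, fun f hf => ?_⟩
  have hi : ∀ i, ‖moments f i‖ₑ ≤ (K i).toNNReal * c.toNNReal * eLpNorm f 2 volume := by
    intro i
    calc ‖moments f i‖ₑ ≤ ∫⁻ v, ‖f v * (collisionInvariant i v : ℂ)‖ₑ :=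
          enorm_integral_le_lintegral_enorm _
      _ ≤ ∫⁻ v, (K i).toNNReal * ‖f v‖ₑ := by
          refine lintegral_mono fun v => ?_
          rw [enorm_mul, mul_comm]
          gcongr
          rw [← ofReal_norm, Complex.norm_real]
          exact ENNReal.ofReal_le_ofReal (hK i v)
      _ = (K i).toNNReal * eLpNorm f 1 volume := by
          rw [lintegral_const_mul' _ _ ENNReal.coe_ne_top, eLpNorm_one_eq_lintegral_enorm]
      _ ≤ (K i).toNNReal * (eLpNorm f 2 volume * c) := by
          gcongr
          exact eLpNorm_le_eLpNorm_mul_rpow_measure_univ one_le_two hf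
      _ = _ := by rw [ENNReal.coe_toNNReal hc]; ring
  refine (enorm_euclidean_le_sum _).trans ((Finset.sum_le_sum fun i _ => hi i).trans_eq ?_)
  rw [← Finset.sum_mul]
  push_cast
  rfl

lemma moments_sub {f g : Torus d → ℂ} (hf : MemLp f 2 volume) (hg : MemLp g 2 volume) :
    moments (f - g) = moments f - moments g := by
  ext i
  simp only [moments, Pi.sub_apply, sub_mul, PiLp.sub_apply]
  exact integral_sub (integrable_moment (hf.integrable one_le_two) i)
    (integrable_moment (hg.integrable one_le_two) i)

lemma memLp_continuous (g : C(Torus d, ℂ)) : MemLp g 2 volume := by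
  refine MemLp.of_bound g.continuous.aestronglyMeasurable ‖g‖ ?_
  exact Filter.Eventually.of_forall g.norm_coe_le_norm

lemma trigPoly_mono {N N' : ℕ} (h : N ≤ N') : trigPoly d N ≤ trigPoly d N' :=
  Submodule.span_mono (Set.image_mono fun _ hk i => (hk i).trans (by exact_mod_cast h))

/-- Moments can be corrected by a trigonometric polynomial of degree one of comparable size. -/
lemma exists_correction (hd : 1 ≤ d) :
    ∃ A : ℝ≥0, ∀ U : EuclideanSpace ℂ (MomentIndex d), ∃ w ∈ trigPoly d 1,
      moments w = U ∧ eLpNorm w 2 volume ≤ A * ‖U‖ₑ := by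
  let T : trigPoly d 1 →ₗ[ℂ] EuclideanSpace ℂ (MomentIndex d) :=
    (momentsLinear d).comp (trigPoly d 1).subtype
  have hT : Function.Surjective T := fun U => by
    obtain ⟨g, hg, h⟩ := exists_moments_eq hd le_rfl U
    exact ⟨⟨g, hg⟩, h⟩
  -- A linear right inverse of the moment map on `ℙ^1` has finite-dimensional domain, hence is
  -- bounded into `L²`; its operator norm is the constant.
  obtain ⟨S, hS⟩ := T.exists_rightInverse_of_surjective (LinearMap.range_eq_top.2 hT)
  let J := ContinuousMap.toLp (E := ℂ) 2 (volume : Measure (Torus d)) ℂ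
  let L : EuclideanSpace ℂ (MomentIndex d) →L[ℂ] Lp ℂ 2 (volume : Measure (Torus d)) :=
    LinearMap.toContinuousLinearMap (J.toLinearMap.comp ((trigPoly d 1).subtype.comp S))
  refine ⟨‖L‖₊, fun U => ⟨S U, (S U).2, LinearMap.congr_fun hS U, ?_⟩⟩
  have h := L.le_opENorm U
  have h2 : ‖L U‖ₑ = eLpNorm (S U : C(Torus d, ℂ)) 2 volume := by
    rw [Lp.enorm_def]
    exact eLpNorm_congr_ae (ContinuousMap.coeFn_toLp (p := 2) (𝕜 := ℂ) volume _)
  rw [← h2]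
  exact h

/-- Any `g` in `ℙ^N` becomes a competitor once its moment defect is corrected. The correction lies
in `ℙ^1 ⊆ ℙ^N`, which is why `A` does not depend on `N`. -/
lemma exists_eLpNorm_constrainedBest_sub_le (hd : 1 ≤ d) :
    ∃ A : ℝ≥0, ∀ (N : ℕ) (h : Torus d → ℂ) (U : EuclideanSpace ℂ (MomentIndex d)),
      1 ≤ N → MemLp h 2 volume → ∀ g ∈ trigPoly d N,
        eLpNorm (⇑(constrainedBest N h U) - h) 2 volume ≤
          eLpNorm (⇑g - h) 2 volume + A * ‖moments g - U‖ₑ := by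
  obtain ⟨A, hA⟩ := exists_correction hd
  refine ⟨A, fun N h U hN hh g hg => ?_⟩
  obtain ⟨w, hw, hwU, hwn⟩ := hA (U - moments g)
  have hbest := (constrainedBest_spec hd hN hh U).2 (g + w)
    (add_mem hg (trigPoly_mono hN hw)) (by
      change momentsLinear d (g + w) = U
      rw [map_add]
      change moments g + moments w = U
      rw [hwU, add_sub_cancel])
  have hgh := (memLp_continuous g).sub hh
  calc eLpNorm (⇑(constrainedBest N h U) - h) 2 volume
      ≤ eLpNorm (fun v => (g + w) v - h v) 2 volume := hbest
    _ = eLpNorm ((⇑g - h) + ⇑w) 2 volume := by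
        congr 1 with v
        simp only [ContinuousMap.add_apply, Pi.add_apply, Pi.sub_apply]
        ring
    _ ≤ eLpNorm (⇑g - h) 2 volume + eLpNorm w 2 volume :=
        eLpNorm_add_le hgh.1 (memLp_continuous w).1 one_le_two
    _ ≤ _ := by
        rw [← enorm_neg (moments g - U), neg_sub]
        gcongr

/-! ### Completeness of the trigonometric monomials and Parseval's identity. -/

lemma expMonomial_neg (k : Fin d → ℤ) (v : Torus d) :
    expMonomial (-k) v = starRingEnd ℂ (expMonomial k v) := by
  simp only [expMonomial, Pi.neg_apply, fourier_neg, ContinuousMap.coe_mk, map_prod]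

lemma expMonomial_add (k l : Fin d → ℤ) (v : Torus d) :
    expMonomial (k + l) v = expMonomial k v * expMonomial l v := by
  simp only [expMonomial, Pi.add_apply, fourier_add, ContinuousMap.coe_mk,
    ← Finset.prod_mul_distrib]

lemma expMonomial_zero : expMonomial (0 : Fin d → ℤ) = 1 := by
  ext v
  simp [expMonomial]

lemma expMonomial_single (i : Fin d) (v : Torus d) :
    expMonomial (Pi.single i 1) v = fourier 1 (v i) := by
  simp only [expMonomial, ContinuousMap.coe_mk]
  rw [Finset.prod_eq_single i]
  · simp
  · intro j _ hj
    simp [hj]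
  · simp

/-- The trigonometric polynomials form a star subalgebra of the continuous functions. -/
noncomputable def trigSubalgebra (d : ℕ) : StarSubalgebra ℂ C(Torus d, ℂ) where
  toSubalgebra := Algebra.adjoin ℂ (Set.range expMonomial)
  star_mem' := by
    change Algebra.adjoin ℂ (Set.range expMonomial) ≤
      star (Algebra.adjoin ℂ (Set.range expMonomial))
    refine Algebra.adjoin_le ?_
    rintro _ ⟨n, rfl⟩
    refine Algebra.subset_adjoin ⟨-n, ?_⟩
    ext1 x
    simp only [expMonomial_neg, starRingEnd_apply, ContinuousMap.star_apply]

/-- Products of monomials are monomials, so generating an algebra adds nothing to the linear span.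
This lets Stone-Weierstrass speak about the span. -/
lemma trigSubalgebra_coe :
    (trigSubalgebra d).toSubalgebra.toSubmodule = Submodule.span ℂ (Set.range expMonomial) := by
  apply Algebra.adjoin_eq_span_of_subset
  refine .trans (fun x => Submonoid.closure_induction (fun _ => id) ⟨0, expMonomial_zero⟩ ?_)
    Submodule.subset_span
  rintro _ _ _ _ ⟨m, rfl⟩ ⟨n, rfl⟩
  refine ⟨m + n, ?_⟩
  ext z
  exact expMonomial_add m n z

lemma trigSubalgebra_separatesPoints : (trigSubalgebra d).SeparatesPoints := by
  intro x y hxy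
  rw [Ne, funext_iff, not_forall] at hxy
  obtain ⟨i, hi⟩ := hxy
  refine ⟨_, ⟨expMonomial (Pi.single i 1), Algebra.subset_adjoin ⟨Pi.single i 1, rfl⟩, rfl⟩, ?_⟩
  beta_reduce
  rw [expMonomial_single, expMonomial_single, fourier_one, fourier_one]
  exact fun h => hi (AddCircle.injective_toCircle Real.two_pi_pos.ne' (Circle.ext h))

lemma span_expMonomial_closure_eq_top :
    (Submodule.span ℂ (Set.range (expMonomial (d := d)))).topologicalClosure = ⊤ := by
  rw [← trigSubalgebra_coe]
  exact congr_arg (Subalgebra.toSubmodule <| StarSubalgebra.toSubalgebra ·)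
    (ContinuousMap.starSubalgebra_topologicalClosure_eq_top_of_separatesPoints _
      trigSubalgebra_separatesPoints)

lemma integral_fourier_of_ne_zero {n : ℤ} (hn : n ≠ 0) :
    ∫ x : AddCircle (2 * π), fourier n x = 0 := by
  have h := congr_fun (fourierCoeff_fourier (T := 2 * π) n) 0
  rw [fourierCoeff, AddCircle.integral_haarAddCircle] at h
  simpa [hn.symm, Real.pi_ne_zero] using h

lemma integral_expMonomial (k : Fin d → ℤ) :
    ∫ v, expMonomial k v = if k = 0 then (((2 * π) ^ d : ℝ) : ℂ) else 0 := by
  split_ifs with h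
  · subst h
    have := momentsLinear_one d
    simpa [momentsLinear, moments, collisionInvariant] using this
  · obtain ⟨i, hi⟩ := Function.ne_iff.1 h
    have : ∀ v : Torus d, expMonomial k v = ∏ i, fourier (k i) (v i) := fun v => rfl
    simp_rw [this]
    rw [integral_fintype_prod_volume_eq_prod (fun i (x : AddCircle (2 * π)) => fourier (k i) x)]
    exact Finset.prod_eq_zero (Finset.mem_univ i) (integral_fourier_of_ne_zero hi)

/-- The normalized monomials in `L²`. -/
noncomputable def monomialLp (k : Fin d → ℤ) : Lp ℂ 2 (volume : Measure (Torus d)) :=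
  (((2 * π) ^ d : ℝ).sqrt⁻¹ : ℂ) • ContinuousMap.toLp (E := ℂ) 2 volume ℂ (expMonomial k)

lemma box_volume_pos (d : ℕ) : 0 < (2 * π) ^ d := by positivity

lemma orthonormal_monomialLp : Orthonormal ℂ (monomialLp (d := d)) := by
  rw [orthonormal_iff_ite]
  intro m n
  have h : inner ℂ (ContinuousMap.toLp (E := ℂ) 2 volume ℂ (expMonomial m))
      (ContinuousMap.toLp (E := ℂ) 2 (volume : Measure (Torus d)) ℂ (expMonomial n)) =
      if m = n then (((2 * π) ^ d : ℝ) : ℂ) else 0 := by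
    rw [ContinuousMap.inner_toLp]
    simp only [← expMonomial_neg, ← expMonomial_add]
    rw [integral_expMonomial]
    simp only [add_neg_eq_zero, eq_comm]
  rw [monomialLp, monomialLp, inner_smul_left, inner_smul_right, h]
  split_ifs
  · rw [map_inv₀, Complex.conj_ofReal, ← Complex.ofReal_inv, ← Complex.ofReal_mul,
      ← Complex.ofReal_mul, ← mul_assoc, ← mul_inv, Real.mul_self_sqrt (box_volume_pos d).le,
      inv_mul_cancel₀ (box_volume_pos d).ne', Complex.ofReal_one]
  · simp

lemma span_monomialLp_closure_eq_top :
    (Submodule.span ℂ (Set.range (monomialLp (d := d)))).topologicalClosure = ⊤ := by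
  have h1 : (Submodule.span ℂ (Set.range fun k : Fin d → ℤ => ContinuousMap.toLp (E := ℂ) 2
      (volume : Measure (Torus d)) ℂ (expMonomial k))).topologicalClosure = ⊤ := by
    simpa only [Submodule.map_span, ContinuousLinearMap.coe_coe, ← Set.range_comp,
      Function.comp_def] using
      (ContinuousMap.toLp_denseRange (p := 2) ℂ (volume : Measure (Torus d)) ℂ
        ENNReal.ofNat_ne_top).topologicalClosure_map_submodule span_expMonomial_closure_eq_top
  refine top_le_iff.1 (h1.symm.trans_le (Submodule.topologicalClosure_mono ?_))
  rw [Submodule.span_le]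
  rintro _ ⟨k, rfl⟩
  have hs : (((2 * π) ^ d : ℝ).sqrt : ℂ) ≠ 0 := by
    exact_mod_cast (Real.sqrt_pos.2 (box_volume_pos d)).ne'
  have : ContinuousMap.toLp (E := ℂ) 2 (volume : Measure (Torus d)) ℂ (expMonomial k) =
      (((2 * π) ^ d : ℝ).sqrt : ℂ) • monomialLp k := by
    rw [monomialLp, smul_inv_smul₀ hs]
  beta_reduce
  rw [this]
  exact Submodule.smul_mem _ _ (Submodule.subset_span ⟨k, rfl⟩)

lemma inner_monomialLp {h : Torus d → ℂ} (hh : MemLp h 2 volume) (k : Fin d → ℤ) :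
    inner ℂ (monomialLp k) (hh.toLp h) =
      (((2 * π) ^ d : ℝ).sqrt : ℂ) * fourierCoefficient h k := by
  have h1 : inner ℂ (ContinuousMap.toLp (E := ℂ) 2 volume ℂ (expMonomial k)) (hh.toLp h) =
      ∫ v, h v * expMonomial (-k) v := by
    rw [L2.inner_def]
    refine integral_congr_ae ?_
    filter_upwards [hh.coeFn_toLp,
      ContinuousMap.coeFn_toLp (p := 2) (𝕜 := ℂ) volume (expMonomial k)] with v h2 h3
    rw [h2, h3, expMonomial_neg]
    rfl
  have hs : (((2 * π) ^ d : ℝ).sqrt : ℂ) ≠ 0 := by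
    exact_mod_cast (Real.sqrt_pos.2 (box_volume_pos d)).ne'
  have hs2 : (((2 * π) ^ d : ℝ) : ℂ) =
      (((2 * π) ^ d : ℝ).sqrt : ℂ) * (((2 * π) ^ d : ℝ).sqrt : ℂ) := by
    rw [← Complex.ofReal_mul, Real.mul_self_sqrt (box_volume_pos d).le]
  rw [monomialLp, inner_smul_left, h1, fourierCoefficient, map_inv₀, Complex.conj_ofReal]
  rw [Complex.ofReal_inv, hs2]
  field_simp

/-- Parseval's identity. -/
lemma eLpNorm_sq_eq_tsum {h : Torus d → ℂ} (hh : MemLp h 2 volume) :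
    eLpNorm h 2 volume ^ 2 =
      ∑' k : Fin d → ℤ, ENNReal.ofReal ((2 * π) ^ d * ‖fourierCoefficient h k‖ ^ 2) := by
  let b : HilbertBasis (Fin d → ℤ) ℂ (Lp ℂ 2 (volume : Measure (Torus d))) :=
    HilbertBasis.mk orthonormal_monomialLp span_monomialLp_closure_eq_top.ge
  have hb : ∀ k, b k = monomialLp k := fun k => by
    rw [HilbertBasis.coe_mk]
  have hsum := (b.hasSum_inner_mul_inner (hh.toLp h) (hh.toLp h))
  have hterm : ∀ k, inner ℂ (hh.toLp h) (b k) * inner ℂ (b k) (hh.toLp h) =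
      (((2 * π) ^ d * ‖fourierCoefficient h k‖ ^ 2 : ℝ) : ℂ) := by
    intro k
    rw [← inner_conj_symm, hb, inner_monomialLp, Complex.conj_mul', norm_mul,
      Complex.norm_real, Real.norm_of_nonneg (Real.sqrt_nonneg _), ← Complex.ofReal_pow, mul_pow,
      Real.sq_sqrt (box_volume_pos d).le]
  simp_rw [hterm] at hsum
  rw [inner_self_eq_norm_sq_to_K] at hsum
  have hsum' : HasSum (fun k => (2 * π) ^ d * ‖fourierCoefficient h k‖ ^ 2) (‖hh.toLp h‖ ^ 2) := by
    refine Complex.hasSum_ofReal.1 ?_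
    rw [Complex.ofReal_pow]
    exact hsum
  rw [← ENNReal.ofReal_tsum_of_nonneg (fun k => by positivity) hsum'.summable, hsum'.tsum_eq,
    ENNReal.ofReal_pow (norm_nonneg _), ofReal_norm, Lp.enorm_def, eLpNorm_congr_ae hh.coeFn_toLp]

/-! ### Spectral accuracy of the Fourier truncation. -/

/-- Truncation of the Fourier series. -/
noncomputable def fourierTruncation (N : ℕ) (h : Torus d → ℂ) : C(Torus d, ℂ) :=
  ∑ k ∈ Fintype.piFinset fun _ : Fin d => Finset.Icc (-(N : ℤ)) N,
    fourierCoefficient h k • expMonomial k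

lemma fourierTruncation_mem (N : ℕ) (h : Torus d → ℂ) : fourierTruncation N h ∈ trigPoly d N :=
  Submodule.sum_mem _ fun _ hk => Submodule.smul_mem _ _ (expMonomial_mem fun i =>
    abs_le.2 (Finset.mem_Icc.1 (Fintype.mem_piFinset.1 hk i)))

lemma integrable_mul_expMonomial {h : Torus d → ℂ} (hh : Integrable h) (k : Fin d → ℤ) :
    Integrable fun v => h v * expMonomial k v :=
  hh.mul_bdd (c := ‖expMonomial k‖) (expMonomial k).continuous.aestronglyMeasurable
    (Filter.Eventually.of_forall (expMonomial k).norm_coe_le_norm)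

lemma fourierCoefficient_expMonomial (k l : Fin d → ℤ) :
    fourierCoefficient (expMonomial l) k = if l = k then 1 else 0 := by
  have : ((((2 * π) ^ d : ℝ) : ℂ)) ≠ 0 := by exact_mod_cast (box_volume_pos d).ne'
  simp_rw [fourierCoefficient, ← expMonomial_add, integral_expMonomial, add_neg_eq_zero]
  split_ifs
  · rw [Complex.ofReal_inv, inv_mul_cancel₀ this]
  · simp

lemma fourierCoefficient_truncation_sub {h : Torus d → ℂ} (hh : MemLp h 2 volume) (N : ℕ)
    (k : Fin d → ℤ) :
    fourierCoefficient (⇑(fourierTruncation N h) - h) k =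
      if ∀ i, |k i| ≤ (N : ℤ) then 0 else -fourierCoefficient h k := by
  have hlin : ∀ g : C(Torus d, ℂ), fourierCoefficient (⇑g - h) k =
      fourierCoefficient g k - fourierCoefficient h k := by
    intro g
    simp only [fourierCoefficient, Pi.sub_apply, sub_mul]
    rw [integral_sub (integrable_mul_expMonomial (integrable_continuous g) _)
      (integrable_mul_expMonomial (hh.integrable one_le_two) _), mul_sub]
  have htr : fourierCoefficient (fourierTruncation N h) k =
      ∑ l ∈ Fintype.piFinset fun _ : Fin d => Finset.Icc (-(N : ℤ)) N,
        fourierCoefficient h l * fourierCoefficient (expMonomial l) k := by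
    rw [fourierCoefficient]
    simp only [fourierTruncation, ContinuousMap.coe_sum, Finset.sum_apply, ContinuousMap.coe_smul,
      Pi.smul_apply, smul_eq_mul, Finset.sum_mul, mul_assoc]
    rw [integral_finsetSum _ fun l _ => (integrable_mul_expMonomial (integrable_continuous _)
      _).const_mul _, Finset.mul_sum]
    refine Finset.sum_congr rfl fun l _ => ?_
    rw [integral_const_mul, fourierCoefficient.eq_def (expMonomial l)]
    ring
  have hmem : (k ∈ Fintype.piFinset fun _ : Fin d => Finset.Icc (-(N : ℤ)) N) ↔
      ∀ i, |k i| ≤ (N : ℤ) := by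
    simp [abs_le]
  rw [hlin, htr]
  simp only [fourierCoefficient_expMonomial, mul_ite, mul_one, mul_zero, Finset.sum_ite_eq', hmem]
  split_ifs <;> simp

/-- The spectral accuracy of truncated Fourier series. -/
lemma eLpNorm_truncation_sub_le {h : Torus d → ℂ} (hh : MemLp h 2 volume) {N : ℕ} (hN : 1 ≤ N)
    {r : ℝ} (hr : 0 ≤ r) :
    eLpNorm (⇑(fourierTruncation N h) - h) 2 volume ≤ sobolevNorm r h / (N : ℝ≥0∞) ^ r := by
  have hN0 : (0 : ℝ) < N := by exact_mod_cast hN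
  have hmem : MemLp (⇑(fourierTruncation N h) - h) 2 volume := (memLp_continuous _).sub hh
  set S : ℝ≥0∞ := ∑' k : Fin d → ℤ, ENNReal.ofReal ((2 * π) ^ d *
    ((1 + ∑ i, (k i : ℝ) ^ 2) ^ r * ‖fourierCoefficient h k‖ ^ 2)) with hS
  have hle : ENNReal.ofReal (((N : ℝ) ^ r) ^ 2) *
      eLpNorm (⇑(fourierTruncation N h) - h) 2 volume ^ 2 ≤ S := by
    rw [eLpNorm_sq_eq_tsum hmem, ← ENNReal.tsum_mul_left]
    refine ENNReal.tsum_le_tsum fun k => ?_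
    rw [fourierCoefficient_truncation_sub hh, ← ENNReal.ofReal_mul (by positivity)]
    refine ENNReal.ofReal_le_ofReal ?_
    split_ifs with hk
    · rw [norm_zero]
      have : 0 ≤ ∑ i, (k i : ℝ) ^ 2 := by positivity
      simp only [ne_eq, OfNat.ofNat_ne_zero, not_false_eq_true, zero_pow, mul_zero]
      positivity
    · push Not at hk
      obtain ⟨i, hi⟩ := hk
      -- A surviving frequency has some `|k i| > N`, so its Sobolev weight is at least `N^{2r}`.
      have h1 : (N : ℝ) ^ 2 ≤ 1 + ∑ i, (k i : ℝ) ^ 2 := by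
        have h2 : (k i : ℝ) ^ 2 ≤ ∑ i, (k i : ℝ) ^ 2 :=
          Finset.single_le_sum (f := fun i => (k i : ℝ) ^ 2) (fun _ _ => sq_nonneg _)
            (Finset.mem_univ i)
        have h3 : (N : ℝ) < |(k i : ℝ)| := by exact_mod_cast hi
        have h4 : (N : ℝ) ^ 2 ≤ |(k i : ℝ)| ^ 2 := pow_le_pow_left₀ hN0.le h3.le 2
        rw [sq_abs] at h4
        linarith
      have h5 : ((N : ℝ) ^ r) ^ 2 ≤ (1 + ∑ i, (k i : ℝ) ^ 2) ^ r := by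
        rw [← Real.rpow_natCast, ← Real.rpow_mul hN0.le, mul_comm r, Real.rpow_mul hN0.le,
          Real.rpow_natCast]
        exact Real.rpow_le_rpow (by positivity) h1 hr
      rw [norm_neg, mul_left_comm]
      gcongr
  have hNr : (N : ℝ≥0∞) ^ r = ENNReal.ofReal ((N : ℝ) ^ r) := by
    rw [← ENNReal.ofReal_rpow_of_pos hN0, ENNReal.ofReal_natCast]
  rw [ENNReal.le_div_iff_mul_le (Or.inl (by rw [hNr]; positivity))
    (Or.inl (by rw [hNr]; exact ENNReal.ofReal_ne_top)), hNr, sobolevNorm, ← hS]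
  rw [one_div, ENNReal.le_rpow_inv_iff two_pos, ENNReal.rpow_two, mul_pow, mul_comm,
    ← ENNReal.ofReal_pow (by positivity)]
  exact hle

/-! ### Uniform bounds for the two constrained projections. -/

lemma exists_eLpNorm_conservativeProjection_le (hd : 1 ≤ d) :
    ∃ A : ℝ≥0, ∀ (N : ℕ) (f : Torus d → ℂ), 1 ≤ N → MemLp f 2 volume →
      eLpNorm (conservativeProjection N f) 2 volume ≤ A * eLpNorm f 2 volume := by
  obtain ⟨A, hA⟩ := exists_eLpNorm_constrainedBest_sub_le hd
  obtain ⟨M, hM⟩ := exists_enorm_moments_le d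
  refine ⟨2 + A * M, fun N f hN hf => ?_⟩
  set h := conservativeProjection N f
  have h0 : moments (⇑(0 : C(Torus d, ℂ))) = 0 := map_zero (momentsLinear d)
  have h1 : eLpNorm (⇑h - f) 2 volume ≤ eLpNorm f 2 volume + A * (M * eLpNorm f 2 volume) := by
    -- The comparison polynomial is `0`: its error is `‖f‖` and its moment defect is the moment
    -- vector of `f`.
    have := hA N f (moments f) hN hf 0 (zero_mem _)
    rw [h0, zero_sub, enorm_neg, ContinuousMap.coe_zero, zero_sub, eLpNorm_neg] at this
    refine this.trans ?_
    gcongr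
    exact hM f hf.1
  calc eLpNorm h 2 volume = eLpNorm ((⇑h - f) + f) 2 volume := by rw [sub_add_cancel]
    _ ≤ eLpNorm (⇑h - f) 2 volume + eLpNorm f 2 volume :=
      eLpNorm_add_le ((memLp_continuous h).sub hf).1 hf.1 one_le_two
    _ ≤ eLpNorm f 2 volume + A * (M * eLpNorm f 2 volume) + eLpNorm f 2 volume := by gcongr
    _ = _ := by push_cast; ring

/-- Projecting `q` onto `ℙ^N` with vanishing moments costs the approximation error and the size of
the moments of any comparison function. -/
lemma exists_eLpNorm_constrainedBest_zero_sub_le (hd : 1 ≤ d) :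
    ∃ A : ℝ≥0, ∀ (N : ℕ) (q q' : Torus d → ℂ) (r : ℝ), 1 ≤ N → 0 ≤ r → MemLp q 2 volume →
      MemLp q' 2 volume →
      eLpNorm (q - ⇑(constrainedBest N q 0)) 2 volume ≤
        A * (sobolevNorm r q / (N : ℝ≥0∞) ^ r + eLpNorm (q' - q) 2 volume + ‖moments q'‖ₑ) := by
  obtain ⟨A, hA⟩ := exists_eLpNorm_constrainedBest_sub_le hd
  obtain ⟨M, hM⟩ := exists_enorm_moments_le d
  refine ⟨1 + A * M + A, fun N q q' r hN hr hq hq' => ?_⟩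
  let g := fourierTruncation N q
  have hg : MemLp g 2 volume := memLp_continuous g
  have ht := eLpNorm_truncation_sub_le hq hN hr
  set t := sobolevNorm r q / (N : ℝ≥0∞) ^ r
  have hmom : ‖moments g‖ₑ ≤ M * t + M * eLpNorm (q' - q) 2 volume + ‖moments q'‖ₑ := by
    have hsplit : moments g = moments (⇑g - q) - moments (q' - q) + moments q' := by
      rw [moments_sub hg hq, moments_sub hq' hq]
      abel
    rw [hsplit]
    refine (enorm_add_le _ _).trans (add_le_add (enorm_sub_le.trans (add_le_add ?_ ?_)) le_rfl)
    · exact (hM _ (hg.sub hq).1).trans (mul_le_mul_right ht _)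
    · exact hM _ (hq'.sub hq).1
  rw [eLpNorm_sub_comm]
  have hbest := hA N q 0 hN hq g (fourierTruncation_mem N q)
  rw [sub_zero] at hbest
  set e := eLpNorm (q' - q) 2 volume
  set m := ‖moments q'‖ₑ
  calc _ ≤ eLpNorm (⇑g - q) 2 volume + A * ‖moments g‖ₑ := hbest
    _ ≤ t + A * (M * t + M * e + m) := by gcongr
    -- The added terms complete the sum to one common constant times `t + e + m`.
    _ ≤ t + A * (M * t + M * e + m) + (A * t + (1 + A) * e + (1 + A * M) * m) := le_self_add
    _ = _ := by push_cast; ring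

end BoltzmannSpectral

/-! ### Assembly of the error estimate. -/

theorem mainTheorem2 (d : ℕ) (hd : 1 ≤ d) (R : ℝ) (hR : 0 < R) (B : ℝ → ℝ → ℝ)
    (hB : BoltzmannSpectral.IsAdmissibleKernel d R B)
    (Ctilde : ℝ) (hCtilde : 0 < Ctilde) (K : ℝ≥0) (r : ℝ) (hr : 1 ≤ r) :
    ∃ C : ℝ≥0, ∀ (f : BoltzmannSpectral.Torus d → ℂ) (δ : ℝ),
      MemLp f 2 volume → eLpNorm f 2 volume ≤ K → 0 < δ →
      ‖BoltzmannSpectral.moments (BoltzmannSpectral.collision B R f f)‖ ≤ Ctilde * δ →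
      ∀ N : ℕ, 1 ≤ N →
        eLpNorm (fun v => BoltzmannSpectral.collision B R f f v -
            BoltzmannSpectral.constrainedCollision B R N
              (BoltzmannSpectral.conservativeProjection N f) v) 2 volume ≤
          C * (eLpNorm (fun v => f v - BoltzmannSpectral.conservativeProjection N f v) 2 volume +
            BoltzmannSpectral.sobolevNorm r
              (BoltzmannSpectral.collision B R (BoltzmannSpectral.conservativeProjection N f)
                (BoltzmannSpectral.conservativeProjection N f)) / (N : ℝ≥0∞) ^ r +
            ENNReal.ofReal δ) := by
  open BoltzmannSpectral in
  obtain ⟨A, hA⟩ := exists_eLpNorm_collision_sub_le hd hB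
  obtain ⟨P, hP⟩ := exists_eLpNorm_conservativeProjection_le hd
  obtain ⟨M, hM⟩ := exists_eLpNorm_constrainedBest_zero_sub_le hd
  -- Lipschitz constant on the set containing both functions: `‖f‖ ≤ K` and `‖f_N^c‖ ≤ P K`.
  let L : ℝ≥0 := A * (K + P * K)
  refine ⟨L + M * (1 + L + Ctilde.toNNReal), fun f δ hf hfK hδ hmom N hN => ?_⟩
  have hh := memLp_continuous (conservativeProjection N f)
  have hhn : eLpNorm (conservativeProjection N f) 2 volume ≤ P * K :=
    (hP N f hN hf).trans (mul_le_mul_right hfK _)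
  set h : Torus d → ℂ := ⇑(conservativeProjection N f)
  have hQf : MemLp (collision B R f f) 2 volume := memLp_collision hd hB hf hf
  have hQh : MemLp (collision B R h h) 2 volume := memLp_collision hd hB hh hh
  have hLip : eLpNorm (collision B R f f - collision B R h h) 2 volume ≤
      L * eLpNorm (f - h) 2 volume := by
    refine (hA f h hf hh).trans ?_
    rw [← mul_assoc]
    refine mul_le_mul_left ?_ _
    push_cast [L]
    gcongr
  -- The function being projected is `Q(h,h)`; the comparison function, whose moments are small, is
  -- `Q(f,f)`.
  have hbest := hM N _ _ r hN (zero_le_one.trans hr) hQh hQf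
  have hm : ‖moments (collision B R f f)‖ₑ ≤ Ctilde.toNNReal * ENNReal.ofReal δ := by
    rw [← ofReal_norm, ← ENNReal.ofReal, ← ENNReal.ofReal_mul hCtilde.le]
    exact ENNReal.ofReal_le_ofReal hmom
  have hc : MemLp (constrainedBest N (collision B R h h) 0) 2 volume := memLp_continuous _
  change eLpNorm (collision B R f f - ⇑(constrainedBest N (collision B R h h) 0)) 2 volume ≤
    _ * (eLpNorm (f - h) 2 volume + _ + _)
  rw [← sub_add_sub_cancel (collision B R f f) (collision B R h h)]
  set e := eLpNorm (f - h) 2 volume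
  set t := sobolevNorm r (collision B R h h) / (N : ℝ≥0∞) ^ r
  set D := ENNReal.ofReal δ
  refine (eLpNorm_add_le (hQf.sub hQh).1 (hQh.sub hc).1 one_le_two).trans ?_
  calc _ ≤ L * e + M * (t + L * e + Ctilde.toNNReal * D) := by
        refine add_le_add hLip (hbest.trans ?_)
        gcongr
    _ ≤ L * e + M * (t + L * e + Ctilde.toNNReal * D) +
        (L * (t + D) + M * ((L + Ctilde.toNNReal) * t + (1 + Ctilde.toNNReal) * e + (1 + L) * D)) :=
        le_self_add
    _ = _ := by push_cast; ring
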